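/- Let $n_y,n_u\ge 0$ be integers. **Continuous time.** $L_{2e}^n$ is the space of (classes of) measurable functions $f:[0,\infty)\to\mathbb R^n$ such that $\|f\|_T:=\|P_Tf\|_{L_2}<\infty$ for all $T\ge 0$, where $P_T$ is truncation to $[0,T]$; its topology is generated by the $\|\cdot\|_T$-balls. $\mathcal L(L_{2e}^m,L_{2e}^n)$ is the space of continuous linear maps $A:L_{2e}^m\to L_{2e}^n$, with the topology generated by the open balls of all $\|A\|_T:=\|P_TA\|_{L_2^m\to L_2^n}$, $T\ge0$. A map $A$ is causal if $P_TAP_T=P_TA$ for all $T\ge0$, and time-invariant if $D_TA=AD_T$ for all $T>0$, where $(D_Tf)(t)=f(t-T)$ for $t\ge T$ and $(D_Tf)(t)=0$ for $t<T$. The causal time-invariant maps in $\mathcal L(L_{2e}^m,L_{2e}^n)$ form $\mathrm{LTI}(L_{2e}^m,L_{2e}^n)$. Let $G\in \mathrm{LTI}(L_{2e}^{n_u},L_{2e}^{n_y})$ and let $S\subset\mathrm{LTI}(L_{2e}^{n_y},L_{2e}^{n_u})$ be a closed linear subspace that is inert with respect to $G$: for every $K\in S$, the entries of the impulse response matrix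 $(gk)$ of $GK$ are functions that are essentially bounded on every bounded interval, so that $(GKf)(t)=\int_0^t (gk)(t-s)f(s)\,ds$ for all $f\in L_{2e}^{n_y}$ and almost all $t\ge 0$. Then $I-GK$ is invertible in $\mathcal L(L_{2e}^{n_y},L_{2e}^{n_y})$ for all $K\in S$, so that $h(K):=-K(I-GK)^{-1}$ is defined on $S$, and the following statements are equivalent: 1. $S$ is quadratically invariant under $G$, that is, $KGK\in S$ for all $K\in S$; 2. $h(S)=S$, where $h(S)=\{h(K):K\in S\}$; 3. $h(S)$ is convex. **Discrete time.** The same holds with $L_{2e}^n$ replaced by the space $\ell_{2e}^n$ of all sequences $f:\mathbb Z_+\to\mathbb R^n$, with $\|f\|_T$, $P_T$, $D_T$ ($T\in\mathbb Z_+$), the topologies and the set LTI defined in the same way from $\ell_2$, and where $S$ is called inert with respect to $G$ if for every $K\in S$ the (complex) spectral radius of $(gk)(0)$ is less than $1$; here $(gk)$ is the discrete impulse response matrix of $GK$. -/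

import Mathlib

open MeasureTheory Set
open scoped ENNReal NNReal Topology

noncomputable section

/-! ### Notions for arbitrary topological vector spaces -/

namespace QuadInv

section General

variable {U Y : Type*}
  [AddCommGroup U] [Module ℝ U] [TopologicalSpace U] [IsTopologicalAddGroup U]
  [AddCommGroup Y] [Module ℝ Y] [TopologicalSpace Y] [IsTopologicalAddGroup Y]

/-- `S` is quadratically invariant under `G`: `K G K ∈ S` for all `K ∈ S`. -/
def IsQuadraticallyInvariant (S : Set (Y →L[ℝ] U)) (G : U →L[ℝ] Y) : Prop :=
  ∀ K ∈ S, K ∘L G ∘L K ∈ S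

/-- The map `h(K) = -K (I - G K)⁻¹`, meaningful for those `K` for which `I - G K` is
invertible in the ring of continuous linear maps `Y → Y`. -/
def h (G : U →L[ℝ] Y) (K : Y →L[ℝ] U) : Y →L[ℝ] U :=
  -(K ∘L Ring.inverse (1 - G ∘L K))

end General

/-- `ℝⁿ` with its Euclidean norm. -/
abbrev E (n : ℕ) : Type := EuclideanSpace ℝ (Fin n)

/-! ### Continuous time: the extended space `L_{2e}ⁿ` -/

/-- Lebesgue measure on the time axis `[0, ∞)`. -/
abbrev timeMeasure : Measure ℝ := volume.restrict (Ici 0)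

/-- Truncation `P_T` on (classes of) measurable functions `[0, ∞) → ℝⁿ`. -/
def truncAE (n : ℕ) (T : ℝ≥0) : (ℝ →ₘ[timeMeasure] E n) →ₗ[ℝ] (ℝ →ₘ[timeMeasure] E n) where
  toFun f := AEEqFun.mk ((Iic (T : ℝ)).indicator f)
    (f.aestronglyMeasurable.indicator measurableSet_Iic)
  map_add' f g := by
    rw [AEEqFun.mk_add_mk, AEEqFun.mk_eq_mk]
    filter_upwards [AEEqFun.coeFn_add f g] with t ht
    by_cases h : t ∈ Iic (T : ℝ) <;> simp [h, ht]
  map_smul' c f := by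
    refine Eq.trans (AEEqFun.mk_eq_mk.2 ?_)
      (AEEqFun.smul_mk c _ (f.aestronglyMeasurable.indicator measurableSet_Iic))
    filter_upwards [AEEqFun.coeFn_smul c f] with t ht
    by_cases h : t ∈ Iic (T : ℝ) <;> simp [h, ht]

/-- Shift `D_T` on (classes of) measurable functions `[0, ∞) → ℝⁿ`:
`(D_T f)(t) = f (t - T)` for `t ≥ T` and `0` for `t < T`. -/
def shiftAE (n : ℕ) (T : ℝ≥0) (f : ℝ →ₘ[timeMeasure] E n) : ℝ →ₘ[timeMeasure] E n :=
  AEEqFun.mk ((Ici (T : ℝ)).indicator fun t => f (t - T))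
    ((f.stronglyMeasurable.comp_measurable
      (measurable_id.sub_const (T : ℝ))).indicator measurableSet_Ici).aestronglyMeasurable

/-- `L_{2e}ⁿ` as a space of classes of functions: those `f` with `P_T f ∈ L₂` for all `T`. -/
def L2eSubmodule (n : ℕ) : Submodule ℝ (ℝ →ₘ[timeMeasure] E n) where
  carrier := {f | ∀ T : ℝ≥0, truncAE n T f ∈ Lp (E n) 2 timeMeasure}
  add_mem' hf hg T := by
    rw [map_add]
    exact add_mem (hf T) (hg T)
  zero_mem' T := by
    rw [map_zero]
    exact zero_mem _
  smul_mem' c f hf T := by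
    rw [map_smul]
    exact Lp.mem_Lp_iff_memLp.2 (((Lp.mem_Lp_iff_memLp.1 (hf T)).const_smul c).ae_eq
      (AEEqFun.coeFn_smul c _).symm)

/-- The extended space `L_{2e}ⁿ`. -/
def L2e (n : ℕ) : Type := L2eSubmodule n

namespace L2e

variable {m n : ℕ}

instance : AddCommGroup (L2e n) := inferInstanceAs (AddCommGroup (L2eSubmodule n))
instance : Module ℝ (L2e n) := inferInstanceAs (Module ℝ (L2eSubmodule n))

/-- The class of functions underlying an element of `L_{2e}ⁿ`. -/
def toAE : L2e n →ₗ[ℝ] (ℝ →ₘ[timeMeasure] E n) := (L2eSubmodule n).subtype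

theorem truncAE_mem_Lp (T : ℝ≥0) (f : L2e n) :
    truncAE n T (toAE f) ∈ Lp (E n) 2 timeMeasure :=
  Subtype.property (p := fun x => x ∈ L2eSubmodule n) f T

/-- `P_T f` as an element of `L₂ⁿ`. -/
def truncLp (T : ℝ≥0) : L2e n →ₗ[ℝ] Lp (E n) 2 timeMeasure where
  toFun f := ⟨truncAE n T (toAE f), truncAE_mem_Lp T f⟩
  map_add' f g := Subtype.ext (map_add (truncAE n T ∘ₗ toAE) f g)
  map_smul' c f := Subtype.ext (map_smul (truncAE n T ∘ₗ toAE) c f)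

/-- The seminorm `‖f‖_T = ‖P_T f‖_{L₂}`. -/
def seminorm (n : ℕ) : SeminormFamily ℝ (L2e n) ℝ≥0 := fun T =>
  (normSeminorm ℝ (Lp (E n) 2 timeMeasure)).comp (truncLp T)

/-- The topology of `L_{2e}ⁿ` is the one generated by the balls of all the `‖·‖_T`. -/
instance : TopologicalSpace (L2e n) := (seminorm n).moduleFilterBasis.topology

theorem withSeminorms (n : ℕ) : WithSeminorms (seminorm n) := ⟨rfl⟩

instance : IsTopologicalAddGroup (L2e n) := (withSeminorms n).topologicalAddGroup
instance : ContinuousSMul ℝ (L2e n) := (withSeminorms n).continuousSMul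

theorem truncAE_mem (T : ℝ≥0) (f : L2e n) :
    truncAE n T (toAE f) ∈ L2eSubmodule n := by
  intro R
  have hf := Lp.mem_Lp_iff_memLp.1 (truncAE_mem_Lp T f)
  refine Lp.mem_Lp_iff_memLp.2 ((hf.indicator (measurableSet_Iic (a := (R : ℝ)))).ae_eq ?_)
  exact (AEEqFun.coeFn_mk _ _).symm

/-- Truncation `P_T` on `L_{2e}ⁿ`. -/
def trunc (T : ℝ≥0) (f : L2e n) : L2e n :=
  (⟨truncAE n T (toAE f), truncAE_mem T f⟩ : L2eSubmodule n)

theorem shiftAE_mem (T : ℝ≥0) (f : L2e n) : shiftAE n T (toAE f) ∈ L2eSubmodule n := by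
  intro R
  have hf : MemLp ((Iic (R : ℝ)).indicator (toAE f)) 2 timeMeasure :=
    (Lp.mem_Lp_iff_memLp.1 (truncAE_mem_Lp R f)).ae_eq (AEEqFun.coeFn_mk _ _)
  have h1 : MemLp ((Ici (0 : ℝ)).indicator ((Iic (R : ℝ)).indicator (toAE f))) 2 volume :=
    (memLp_indicator_iff_restrict measurableSet_Ici).2 hf
  have h2 := h1.comp_measurePreserving (measurePreserving_sub_right volume (T : ℝ))
  have h3 := (h2.indicator (measurableSet_Iic (a := (R : ℝ)))).restrict (Ici 0)
  refine Lp.mem_Lp_iff_memLp.2 (h3.ae_eq ?_)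
  refine Filter.EventuallyEq.trans ?_ (AEEqFun.coeFn_mk _ _).symm
  filter_upwards [AEEqFun.coeFn_mk ((Ici (T : ℝ)).indicator fun t => toAE f (t - T))
    ((((toAE f).stronglyMeasurable.comp_measurable
      (measurable_id.sub_const (T : ℝ))).indicator
        measurableSet_Ici).aestronglyMeasurable (μ := timeMeasure))] with t ht
  have ht' : (shiftAE n T (toAE f)) t = (Ici (T : ℝ)).indicator (fun t => toAE f (t - T)) t := ht
  by_cases hR : t ≤ R
  · have hT : t ≤ R + T := le_trans hR (by simp)
    by_cases hT0 : (T : ℝ) ≤ t <;> simp [indicator, ht', hR, hT0, hT]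
  · simp [indicator, hR]

/-- Shift `D_T` on `L_{2e}ⁿ`. -/
def shift (T : ℝ≥0) (f : L2e n) : L2e n :=
  (⟨shiftAE n T (toAE f), shiftAE_mem T f⟩ : L2eSubmodule n)

/-- Causal, time-invariant continuous linear maps `L_{2e}ᵐ → L_{2e}ⁿ`:
`P_T A P_T = P_T A` for `T ≥ 0` and `D_T A = A D_T` for `T > 0`. -/
def IsCausalLTI (A : L2e m →L[ℝ] L2e n) : Prop :=
  (∀ (T : ℝ≥0) (f : L2e m), trunc T (A (trunc T f)) = trunc T (A f)) ∧
    ∀ T : ℝ≥0, 0 < T → ∀ f : L2e m, shift T (A f) = A (shift T f)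

/-- `‖A‖_T = ‖P_T A‖`, the operator norm from `L₂ᵐ` to `L₂ⁿ`, with values in `[0, ∞]`. -/
def opNorm (T : ℝ≥0) (A : L2e m →L[ℝ] L2e n) : ℝ≥0∞ :=
  ⨆ (f : L2e m) (_ : eLpNorm (toAE f) 2 timeMeasure ≤ 1), ENNReal.ofReal (seminorm n T (A f))

/-- The topology on the continuous linear maps `L_{2e}ᵐ → L_{2e}ⁿ` generated by all open
balls `{B : ‖B - A‖_T < r}`. -/
abbrev opTopology (m n : ℕ) : TopologicalSpace (L2e m →L[ℝ] L2e n) :=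
  TopologicalSpace.generateFrom
    {O | ∃ (T : ℝ≥0) (A : L2e m →L[ℝ] L2e n) (r : ℝ≥0∞), O = {B | opNorm T (B - A) < r}}

/-- The matrix function `k` is the impulse response of `A`:
`(A f)(t) = ∫₀ᵗ k(t - s) f(s) ds` for all inputs `f` and almost all `t ≥ 0`; its entries are
required to lie in `L_{∞e}`, i.e. to be essentially bounded on bounded time intervals. -/
def HasBoundedImpulseResponse (A : L2e m →L[ℝ] L2e n) (k : ℝ → Matrix (Fin n) (Fin m) ℝ) :
    Prop :=
  (∀ i j, ∀ T : ℝ≥0, MemLp ((Iic (T : ℝ)).indicator fun t => k t i j) ∞ timeMeasure) ∧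
    ∀ f : L2e m, ∀ᵐ t ∂timeMeasure, ∀ i,
      toAE (A f) t i = ∫ s in (0 : ℝ)..t, ∑ j, k (t - s) i j * toAE f s j

/-- `S` is inert with respect to `G`: for all `K ∈ S` the impulse response matrix of `G K`
has its entries in `L_{∞e}`. -/
def IsInert (S : Set (L2e n →L[ℝ] L2e m)) (G : L2e m →L[ℝ] L2e n) : Prop :=
  ∀ K ∈ S, ∃ k : ℝ → Matrix (Fin n) (Fin n) ℝ, HasBoundedImpulseResponse (G ∘L K) k

end L2e

/-! ### Discrete time: the extended space `ℓ_{2e}ⁿ` -/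

/-- The extended space `ℓ_{2e}ⁿ`. Truncated sequences are always square summable, so that this
is the space of all sequences in `ℝⁿ`. -/
def Ell2e (n : ℕ) : Type := ℕ → E n

namespace Ell2e

variable {m n : ℕ}

instance : AddCommGroup (Ell2e n) := inferInstanceAs (AddCommGroup (ℕ → E n))
instance : Module ℝ (Ell2e n) := inferInstanceAs (Module ℝ (ℕ → E n))

/-- The sequence underlying an element of `ℓ_{2e}ⁿ`. -/
def toSeq : Ell2e n ≃ₗ[ℝ] (ℕ → E n) := LinearEquiv.refl ℝ _

/-- Truncation `P_T` on `ℓ_{2e}ⁿ`. -/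
def trunc (T : ℕ) (f : Ell2e n) : Ell2e n :=
  toSeq.symm fun t => if t ≤ T then toSeq f t else 0

/-- Shift `D_T` on `ℓ_{2e}ⁿ`. -/
def shift (T : ℕ) (f : Ell2e n) : Ell2e n :=
  toSeq.symm fun t => if t < T then 0 else toSeq f (t - T)

theorem memℓp_trunc (T : ℕ) (f : Ell2e n) : Memℓp (toSeq (trunc T f)) 2 := by
  refine memℓp_gen (summable_of_hasFiniteSupport ((Set.finite_Iic T).subset ?_))
  intro t ht
  by_contra hT
  simp only [mem_Iic] at hT
  exact ht (by simp [trunc, hT])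

/-- `P_T f` as an element of `ℓ₂ⁿ`. -/
def truncLp (T : ℕ) : Ell2e n →ₗ[ℝ] lp (fun _ : ℕ => E n) 2 where
  toFun f := ⟨toSeq (trunc T f), memℓp_trunc T f⟩
  map_add' f g := by
    ext t : 2
    rw [lp.coeFn_add, Pi.add_apply]
    by_cases h : t ≤ T <;> simp [trunc, h]
  map_smul' c f := by
    ext t : 2
    by_cases h : t ≤ T <;> simp [trunc, h]

/-- The seminorm `‖f‖_T = ‖P_T f‖_{ℓ₂}`. -/
def seminorm (n : ℕ) : SeminormFamily ℝ (Ell2e n) ℕ := fun T =>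
  (normSeminorm ℝ (lp (fun _ : ℕ => E n) 2)).comp (truncLp T)

/-- The topology of `ℓ_{2e}ⁿ` is the one generated by the balls of all the `‖·‖_T`. -/
instance : TopologicalSpace (Ell2e n) := (seminorm n).moduleFilterBasis.topology

theorem withSeminorms (n : ℕ) : WithSeminorms (seminorm n) := ⟨rfl⟩

instance : IsTopologicalAddGroup (Ell2e n) := (withSeminorms n).topologicalAddGroup
instance : ContinuousSMul ℝ (Ell2e n) := (withSeminorms n).continuousSMul

/-- Causal, time-invariant continuous linear maps `ℓ_{2e}ᵐ → ℓ_{2e}ⁿ`: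
`P_T A P_T = P_T A` for `T ≥ 0` and `D_T A = A D_T` for `T > 0`. -/
def IsCausalLTI (A : Ell2e m →L[ℝ] Ell2e n) : Prop :=
  (∀ (T : ℕ) (f : Ell2e m), trunc T (A (trunc T f)) = trunc T (A f)) ∧
    ∀ T : ℕ, 0 < T → ∀ f : Ell2e m, shift T (A f) = A (shift T f)

/-- `‖A‖_T = ‖P_T A‖`, the operator norm from `ℓ₂ᵐ` to `ℓ₂ⁿ`, with values in `[0, ∞]`. -/
def opNorm (T : ℕ) (A : Ell2e m →L[ℝ] Ell2e n) : ℝ≥0∞ :=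
  ⨆ (f : lp (fun _ : ℕ => E m) 2) (_ : ‖f‖ ≤ 1),
    ENNReal.ofReal (seminorm n T (A (toSeq.symm (f : ℕ → E m))))

/-- The topology on the continuous linear maps `ℓ_{2e}ᵐ → ℓ_{2e}ⁿ` generated by all open
balls `{B : ‖B - A‖_T < r}`. -/
abbrev opTopology (m n : ℕ) : TopologicalSpace (Ell2e m →L[ℝ] Ell2e n) :=
  TopologicalSpace.generateFrom
    {O | ∃ (T : ℕ) (A : Ell2e m →L[ℝ] Ell2e n) (r : ℝ≥0∞), O = {B | opNorm T (B - A) < r}}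

/-- The unit impulse at time `0` in the `j`-th input channel. -/
def impulse (j : Fin m) : Ell2e m :=
  toSeq.symm fun t => if t = 0 then EuclideanSpace.single j 1 else 0

/-- The discrete impulse response matrix of `A`: the `(i, j)` entry at time `t` is the `i`-th
output at time `t` for the unit impulse in the `j`-th input. -/
def impulseResponse (A : Ell2e m →L[ℝ] Ell2e n) (t : ℕ) : Matrix (Fin n) (Fin m) ℝ :=
  Matrix.of fun i j => toSeq (A (impulse j)) t i

/-- `S` is inert with respect to `G`: for all `K ∈ S` the value at time `0` of the impulse
response matrix of `G K` has (complex) spectral radius less than `1`. The entries of the impulse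
response are real sequences, hence automatically in `ℓ_e`. -/
def IsInert (S : Set (Ell2e n →L[ℝ] Ell2e m)) (G : Ell2e m →L[ℝ] Ell2e n) : Prop :=
  ∀ K ∈ S, spectralRadius ℂ ((impulseResponse (G ∘L K) 0).map (algebraMap ℝ ℂ)) < 1

end Ell2e

end QuadInv

end

/-! Both time axes reduce to one algebraic argument in `tfae_of_polynomial_approx`, which needs two
facts: every operator involved is bounded from the `T`-seminorm to the same `T`-seminorm, and `(1 -
GK)⁻¹` is a limit of polynomials in `GK`, uniformly in each such seminorm. The first follows from
causality (`DiagonallyBounded.of_causal`).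

Given these, quadratic invariance polarises to `K (GK)ⁿ ∈ S`, so closedness puts `h(K)` in `S`;
since `h` is an involution (`h_h`), `h(S) = S`. A subspace is convex. Conversely, `h(S)` contains `0
= h(0)`, so convexity puts `(1 - μ) h(K)` in `h(S)`; applying `h` again gives `K (1 - μ GK)⁻¹ ∈ S`
for `0 ≤ μ < 1`. The difference quotient of this curve at `μ = 0` tends to `KGK`, which closedness
keeps in `S`.

The polynomial approximation rests on a Neumann series criterion (`isUnit_one_sub_of_summable`). In
continuous time, a locally bounded kernel makes `GK` a Volterra operator, whose powers decay
factorially on `[0, T]`. In discrete time a strictly causal operator is nilpotent up to each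
horizon. A general `A = GK` is reduced to this case: with `D` its response at time `0`, the minimal
polynomial of `1 - D` yields a polynomial `ν` with `ν(D) = 0` and `ν(1) = 1`, so `ν(A)` is strictly
causal and `1 - A` divides `1 - ν(A)`. -/

noncomputable section

namespace QuadInv

set_option linter.unusedSectionVars false

/-! ### Operators that are bounded in each seminorm of a family -/

section Seminorms

open Polynomial

variable {ι U X Y Z : Type*}
  [AddCommGroup U] [Module ℝ U] [TopologicalSpace U] [IsTopologicalAddGroup U] [ContinuousConstSMul ℝ U]
  [AddCommGroup X] [Module ℝ X] [TopologicalSpace X] [IsTopologicalAddGroup X] [ContinuousConstSMul ℝ X]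
  [AddCommGroup Y] [Module ℝ Y] [TopologicalSpace Y] [IsTopologicalAddGroup Y] [ContinuousConstSMul ℝ Y]
  [AddCommGroup Z] [Module ℝ Z] [TopologicalSpace Z] [IsTopologicalAddGroup Z] [ContinuousConstSMul ℝ Z]

/-- `A` is bounded from the seminorm `p T` to the seminorm `q T`, for every index `T`. -/
def DiagonallyBounded (p : SeminormFamily ℝ X ι) (q : SeminormFamily ℝ Z ι) (A : X →L[ℝ] Z) :
    Prop :=
  ∀ T, ∃ C, 0 ≤ C ∧ ∀ f, q T (A f) ≤ C * p T f

namespace DiagonallyBounded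

variable {p : SeminormFamily ℝ X ι} {q : SeminormFamily ℝ Y ι} {r : SeminormFamily ℝ Z ι}

theorem comp {A : Y →L[ℝ] Z} {B : X →L[ℝ] Y} (hA : DiagonallyBounded q r A)
    (hB : DiagonallyBounded p q B) : DiagonallyBounded p r (A ∘L B) := by
  intro T
  obtain ⟨C, hC, h1⟩ := hA T
  obtain ⟨D, hD, h2⟩ := hB T
  refine ⟨C * D, mul_nonneg hC hD, fun f => (h1 _).trans ?_⟩
  rw [mul_assoc]
  exact mul_le_mul_of_nonneg_left (h2 f) hC

theorem add {A B : X →L[ℝ] Y} (hA : DiagonallyBounded p q A) (hB : DiagonallyBounded p q B) :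
    DiagonallyBounded p q (A + B) := by
  intro T
  obtain ⟨C, hC, h1⟩ := hA T
  obtain ⟨D, hD, h2⟩ := hB T
  refine ⟨C + D, add_nonneg hC hD, fun f => (map_add_le_add (q T) _ _).trans ?_⟩
  rw [add_mul]
  exact add_le_add (h1 f) (h2 f)

theorem smul {A : X →L[ℝ] Y} (c : ℝ) (hA : DiagonallyBounded p q A) :
    DiagonallyBounded p q (c • A) := by
  intro T
  obtain ⟨C, hC, h1⟩ := hA T
  refine ⟨|c| * C, by positivity, fun f => ?_⟩
  rw [smul_apply, map_smul_eq_mul, mul_assoc, Real.norm_eq_abs]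
  exact mul_le_mul_of_nonneg_left (h1 f) (abs_nonneg c)

theorem one : DiagonallyBounded p p 1 := fun _ => ⟨1, zero_le_one, fun f => by simp⟩

theorem pow {A : X →L[ℝ] X} (hA : DiagonallyBounded p p A) (n : ℕ) :
    DiagonallyBounded p p (A ^ n) := by
  induction n with
  | zero => exact one
  | succ n ih => exact ih.comp hA

theorem aeval {A : X →L[ℝ] X} (hA : DiagonallyBounded p p A)
    (P : ℝ[X]) : DiagonallyBounded p p (aeval A P) := by
  induction P using Polynomial.induction_on' with
  | add P Q hP hQ => rw [map_add]; exact hP.add hQ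
  | monomial n c =>
    rw [aeval_monomial, ← Algebra.smul_def]
    exact (hA.pow n).smul c

/-- Continuity alone bounds `q T ∘ A` by finitely many seminorms `p R`, with `R` possibly beyond
`T`. Causality allows `f` to be replaced by its truncation, on which each `p R` is at most `p T f`.
-/
theorem of_causal (hp : WithSeminorms p) (hq : WithSeminorms q) {A : X →L[ℝ] Y}
    (P : ι → X → X) (hP : ∀ T R f, p R (P T f) ≤ p T f)
    (hA : ∀ T f, q T (A f) ≤ q T (A (P T f))) : DiagonallyBounded p q A := by
  intro T
  have hc : Continuous ((q T).comp (A : X →ₗ[ℝ] Y)) := (hq.continuous_seminorm T).comp A.continuous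
  obtain ⟨s, C, -, h⟩ := Seminorm.bound_of_continuous hp _ hc
  refine ⟨C, C.2, fun f => (hA T f).trans ((h (P T f)).trans ?_)⟩
  rw [smul_apply, NNReal.smul_def, smul_eq_mul]
  exact mul_le_mul_of_nonneg_left
    (Seminorm.finset_sup_apply_le (apply_nonneg _ _) fun R _ => hP T R f) C.2

end DiagonallyBounded

/-! ### Neumann series in a complete family of seminorms -/

/-- Every series that converges absolutely in all seminorms of the family has a sum. -/
def SeriesComplete (p : SeminormFamily ℝ X ι) : Prop :=
  ∀ x : ℕ → X, (∀ T, Summable fun n => p T (x n)) →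
    ∃ y, ∀ T, Filter.Tendsto (fun m => p T (y - ∑ n ∈ Finset.range m, x n)) Filter.atTop (𝓝 0)

/-- The finite identity `f = (∑ n < m, Nⁿ) (1 - N) f + Nᵐ f` gives injectivity and the a priori
bound that makes the inverse continuous; completeness is needed only for surjectivity. The
approximation error of the inverse `R` is `Nᵐ R f`. -/
theorem isUnit_one_sub_of_summable {p : SeminormFamily ℝ X ι} (hp : WithSeminorms p)
    (hsep : ∀ x, (∀ T, p T x = 0) → x = 0) (hcomp : SeriesComplete p) {N : X →L[ℝ] X}
    (hN : ∀ T, ∃ c : ℕ → ℝ, Summable c ∧ ∀ n f, p T ((N ^ n) f) ≤ c n * p T f) :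
    IsUnit (1 - N) ∧ ∀ T, ∀ ε > 0, ∃ m : ℕ, ∀ f,
      p T (Ring.inverse (1 - N) f - (∑ n ∈ Finset.range m, N ^ n) f) ≤ ε * p T f := by
  choose c hc hcN using hN
  have key : ∀ (m : ℕ) (f : X),
      f = (∑ n ∈ Finset.range m, N ^ n) ((1 - N) f) + (N ^ m) f := by
    intro m f
    have := congrArg (fun A : X →L[ℝ] X => A f) (geom_sum_mul_neg N m)
    simp only [mul_apply_eq_comp, sub_apply] at this ⊢
    rw [this]; simp
  have key' : ∀ (m : ℕ) (f : X),
      (1 - N) ((∑ n ∈ Finset.range m, N ^ n) f) = f - (N ^ m) f := by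
    intro m f
    have := congrArg (fun A : X →L[ℝ] X => A f) (mul_neg_geom_sum N m)
    rwa [mul_apply_eq_comp, sub_apply] at this
  have hbd : ∀ T, ∃ C, 0 ≤ C ∧ ∀ f, p T f ≤ C * p T ((1 - N) f) := by
    intro T
    -- With `c T m < 1/2` the term `Nᵐ f` is absorbed into the left-hand side, at the price of the
    -- factor `2`.
    obtain ⟨m, hm⟩ := (((hc T).tendsto_atTop_zero).eventually
      (gt_mem_nhds (show (0 : ℝ) < 1 / 2 by norm_num))).exists
    refine ⟨2 * ∑ n ∈ Finset.range m, |c T n|, by positivity, fun f => ?_⟩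
    have h1 : p T f ≤ p T ((∑ n ∈ Finset.range m, N ^ n) ((1 - N) f)) + p T ((N ^ m) f) := by
      conv_lhs => rw [key m f]
      exact map_add_le_add _ _ _
    have h2 : p T ((∑ n ∈ Finset.range m, N ^ n) ((1 - N) f)) ≤
        (∑ n ∈ Finset.range m, |c T n|) * p T ((1 - N) f) := by
      rw [sum_apply, Finset.sum_mul]
      refine (Finset.le_sum_of_subadditive (p T) (map_zero _).le (map_add_le_add _) _ _).trans (Finset.sum_le_sum fun n _ => (hcN T n _).trans ?_)
      exact mul_le_mul_of_nonneg_right (le_abs_self _) (apply_nonneg _ _)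
    have h3 := hcN T m f
    have h4 := mul_le_mul_of_nonneg_right hm.le (apply_nonneg (p T) f)
    linarith
  have hinj : Function.Injective (1 - N : X →L[ℝ] X) := by
    rw [injective_iff_map_eq_zero]
    intro f hf
    refine hsep f fun T => ?_
    obtain ⟨C, -, h⟩ := hbd T
    have := h f
    rw [hf, map_zero, mul_zero] at this
    exact le_antisymm this (apply_nonneg _ _)
  have hsurj : Function.Surjective (1 - N : X →L[ℝ] X) := by
    intro g
    obtain ⟨y, hy⟩ := hcomp (fun n => (N ^ n) g) fun T =>
      Summable.of_nonneg_of_le (fun n => apply_nonneg _ _) (fun n => hcN T n g)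
        ((hc T).mul_right _)
    refine ⟨y, sub_eq_zero.1 (hsep _ fun T => le_antisymm ?_ (apply_nonneg _ _))⟩
    -- The defect is `(1 - N)` of the tail of the series minus `Nᵐ g`; both tend to zero, and `c T
    -- 1` bounds `N` itself.
    have hb : ∀ m : ℕ, p T ((1 - N) y - g) ≤
        (1 + c T 1) * p T (y - ∑ n ∈ Finset.range m, (N ^ n) g) + c T m * p T g := by
      intro m
      set z := y - ∑ n ∈ Finset.range m, (N ^ n) g with hz
      have e : (1 - N) y - g = (1 - N) z - (N ^ m) g := by
        have := key' m g
        rw [sum_apply] at this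
        rw [hz, map_sub, this]; abel
      have h1 : p T ((1 - N) z) ≤ p T z + c T 1 * p T z := by
        refine (map_sub_le_add (p T) z (N z)).trans ?_
        have := hcN T 1 z
        rw [pow_one] at this
        linarith
      rw [e]
      have := map_sub_le_add (p T) ((1 - N) z) ((N ^ m) g)
      have := hcN T m g
      linarith
    have hlim := (((hy T).const_mul (1 + c T 1)).add
      ((hc T).tendsto_atTop_zero.mul_const (p T g)))
    simp only [mul_zero, zero_mul, add_zero] at hlim
    exact ge_of_tendsto' hlim hb
  let e : X ≃ₗ[ℝ] X := LinearEquiv.ofBijective ((1 - N : X →L[ℝ] X) : X →ₗ[ℝ] X) ⟨hinj, hsurj⟩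
  have he : ∀ f, (1 - N) (e.symm f) = f := fun f => e.apply_symm_apply f
  have he' : ∀ f, e.symm ((1 - N) f) = f := fun f => e.symm_apply_apply f
  have hcont : Continuous e.symm := by
    refine WithSeminorms.continuous_of_isBounded hp hp (e.symm : X →ₗ[ℝ] X) fun T => ?_
    obtain ⟨C, hC, h⟩ := hbd T
    refine ⟨{T}, ⟨C, hC⟩, fun f => ?_⟩
    have := h (e.symm f)
    rw [he] at this
    rw [Finset.sup_singleton]
    exact this
  let R : X →L[ℝ] X := ⟨e.symm, hcont⟩
  have hR1 : (1 - N) * R = 1 := ContinuousLinearMap.ext he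
  have hR2 : R * (1 - N) = 1 := ContinuousLinearMap.ext he'
  have hu : IsUnit (1 - N) := ⟨⟨1 - N, R, hR1, hR2⟩, rfl⟩
  have hinv : Ring.inverse (1 - N) = R := Ring.inverse_unit ⟨1 - N, R, hR1, hR2⟩
  refine ⟨hu, fun T ε hε => ?_⟩
  obtain ⟨C, hC, h⟩ := hbd T
  obtain ⟨m, hm⟩ := (((hc T).tendsto_atTop_zero.mul_const C).eventually
    (gt_mem_nhds (show (0 : ℝ) * C < ε by simpa using hε))).exists
  refine ⟨m, fun f => ?_⟩
  have h1 : Ring.inverse (1 - N) f - (∑ n ∈ Finset.range m, N ^ n) f = (N ^ m) (R f) := by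
    rw [hinv, sub_eq_iff_eq_add']
    have := key m (R f)
    rwa [show (1 - N) (R f) = f from he f] at this
  rw [h1]
  have h2 : p T (R f) ≤ C * p T f := by
    have := h (R f)
    rwa [show (1 - N) (R f) = f from he f] at this
  have h0 : 0 ≤ p T (R f) := apply_nonneg _ _
  -- The constants `c T m` carry no sign assumption; they are forced to be nonnegative only when `p
  -- T (R f)` is nonzero.
  by_cases h3 : p T (R f) = 0
  · have := hcN T m (R f)
    rw [h3, mul_zero] at this
    exact this.trans (mul_nonneg hε.le (apply_nonneg _ _))
  have h4 : 0 ≤ c T m := by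
    by_contra hneg
    have := hcN T m (R f)
    have := apply_nonneg (p T) ((N ^ m) (R f))
    have := mul_neg_of_neg_of_pos (not_le.1 hneg) (lt_of_le_of_ne h0 (Ne.symm h3))
    linarith
  calc p T ((N ^ m) (R f)) ≤ c T m * p T (R f) := hcN T m _
    _ ≤ c T m * (C * p T f) := mul_le_mul_of_nonneg_left h2 h4
    _ = (c T m * C) * p T f := by ring
    _ ≤ ε * p T f := mul_le_mul_of_nonneg_right hm.le (apply_nonneg _ _)

/-! ### Quadratic invariance -/

/-- `1 - G h(K) = 1 + GK (1 - GK)⁻¹ = (1 - GK)⁻¹`, so the second application of `h` undoes the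
first. -/
theorem h_h {G : U →L[ℝ] Y} {K : Y →L[ℝ] U} (hK : IsUnit (1 - G ∘L K)) :
    h G (h G K) = K := by
  obtain ⟨u, hu⟩ := hK
  have h1 : h G K = -(K ∘L (↑u⁻¹ : Y →L[ℝ] Y)) := by rw [h, ← hu, Ring.inverse_unit]
  have h2 : 1 - G ∘L h G K = (↑u⁻¹ : Y →L[ℝ] Y) := by
    have h3 : G ∘L K = 1 - (u : Y →L[ℝ] Y) := by rw [hu]; abel
    rw [h1, ContinuousLinearMap.comp_neg, ← ContinuousLinearMap.comp_assoc, h3]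
    change 1 - -((1 - (u : Y →L[ℝ] Y)) * (↑u⁻¹ : Y →L[ℝ] Y)) = _
    rw [sub_mul, Units.mul_inv]
    simp
  rw [h, h2, Ring.inverse_unit, inv_inv, h1, ContinuousLinearMap.neg_comp, neg_neg,
    ContinuousLinearMap.comp_assoc]
  change K ∘L ((↑u⁻¹ : Y →L[ℝ] Y) * (u : Y →L[ℝ] Y)) = K
  rw [Units.inv_mul]
  exact ContinuousLinearMap.comp_id K

/-- Polarise `A ↦ A G A` at `K` and `K (GK)ⁿ`: both cross terms equal `K (GK)ⁿ⁺¹`, so twice this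
operator lies in `S`. -/
theorem IsQuadraticallyInvariant.comp_pow_mem {S : Submodule ℝ (Y →L[ℝ] U)} {G : U →L[ℝ] Y}
    (hS : IsQuadraticallyInvariant (S : Set (Y →L[ℝ] U)) G) {K : Y →L[ℝ] U} (hK : K ∈ S) (n : ℕ) :
    K ∘L (G ∘L K) ^ n ∈ S := by
  induction n with
  | zero => exact hK
  | succ n ih =>
    have e1 : K ∘L G ∘L (K ∘L (G ∘L K) ^ n) = K ∘L (G ∘L K) ^ (n + 1) := by
      rw [pow_succ']; rfl
    have e2 : (K ∘L (G ∘L K) ^ n) ∘L G ∘L K = K ∘L (G ∘L K) ^ (n + 1) := by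
      rw [pow_succ]; rfl
    have h1 := hS _ (S.add_mem hK ih)
    have h2 := S.sub_mem (S.sub_mem h1 (hS _ hK)) (hS _ ih)
    have e3 : (K + K ∘L (G ∘L K) ^ n) ∘L G ∘L (K + K ∘L (G ∘L K) ^ n) - K ∘L G ∘L K -
        (K ∘L (G ∘L K) ^ n) ∘L G ∘L (K ∘L (G ∘L K) ^ n) =
        (2 : ℝ) • (K ∘L (G ∘L K) ^ (n + 1)) := by
      rw [two_smul]
      nth_rw 1 [← e1]
      rw [← e2]
      simp only [ContinuousLinearMap.add_comp, ContinuousLinearMap.comp_add]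
      abel
    rw [e3] at h2
    exact (S.smul_mem_iff two_ne_zero).1 h2

theorem IsQuadraticallyInvariant.comp_aeval_mem {S : Submodule ℝ (Y →L[ℝ] U)} {G : U →L[ℝ] Y}
    (hS : IsQuadraticallyInvariant (S : Set (Y →L[ℝ] U)) G) {K : Y →L[ℝ] U} (hK : K ∈ S)
    (P : ℝ[X]) : K ∘L aeval (G ∘L K) P ∈ S := by
  induction P using Polynomial.induction_on' with
  | add P Q hP hQ => rw [map_add, ContinuousLinearMap.comp_add]; exact S.add_mem hP hQ
  | monomial n c =>
    rw [aeval_monomial, ← Algebra.smul_def, ContinuousLinearMap.comp_smul]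
    exact S.smul_mem c (hS.comp_pow_mem hK n)

/-- The segment from `0 = h(0)` to `h(K)` lies in the image of `h`, so `(1 - μ) h(K) = h(K')` with
`K' ∈ S`. As `1 - (1 - μ) G h(K) = (1 - μ GK) (1 - GK)⁻¹`, the involution gives `K' = (1 - μ) K (1 -
μ GK)⁻¹`. -/
theorem comp_inverse_one_sub_smul_mem {S : Submodule ℝ (Y →L[ℝ] U)} {G : U →L[ℝ] Y}
    (hunit : ∀ K ∈ S, IsUnit (1 - G ∘L K)) (hconv : Convex ℝ (h G '' (S : Set (Y →L[ℝ] U))))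
    {K : Y →L[ℝ] U} (hK : K ∈ S) {μ : ℝ} (h0 : 0 ≤ μ) (h1 : μ < 1) :
    K ∘L Ring.inverse (1 - μ • (G ∘L K)) ∈ S := by
  obtain ⟨K', hK', e⟩ : (1 - μ) • h G K ∈ h G '' (S : Set (Y →L[ℝ] U)) := by
    have hz : (0 : Y →L[ℝ] U) ∈ h G '' (S : Set (Y →L[ℝ] U)) :=
      ⟨0, S.zero_mem, by simp [h]⟩
    simpa using hconv (mem_image_of_mem _ hK) hz (by linarith : 0 ≤ 1 - μ) h0 (by ring)
  have hμ : IsUnit (1 - μ • (G ∘L K)) := by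
    have := hunit _ (S.smul_mem μ hK)
    rwa [ContinuousLinearMap.comp_smul] at this
  have h2 : K' = h G ((1 - μ) • h G K) := by rw [← e, h_h (hunit _ hK')]
  obtain ⟨u, hu⟩ := hunit K hK
  obtain ⟨v, hv⟩ := hμ
  have e1 : h G K = -(K ∘L (↑u⁻¹ : Y →L[ℝ] Y)) := by rw [h, ← hu, Ring.inverse_unit]
  have h3 : G ∘L K = 1 - (u : Y →L[ℝ] Y) := by rw [hu]; abel
  have e2 : 1 - G ∘L ((1 - μ) • h G K) = ((v * u⁻¹ : (Y →L[ℝ] Y)ˣ) : Y →L[ℝ] Y) := by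
    rw [e1, ContinuousLinearMap.comp_smul, ContinuousLinearMap.comp_neg,
      ← ContinuousLinearMap.comp_assoc, Units.val_mul, hv, h3]
    change 1 - (1 - μ) • -((1 - (u : Y →L[ℝ] Y)) * (↑u⁻¹ : Y →L[ℝ] Y)) = _
    simp only [sub_mul, smul_mul_assoc, Units.mul_inv, one_mul, smul_sub, sub_smul, one_smul,
      neg_sub]
    abel
  have e3 : K' = (1 - μ) • (K ∘L Ring.inverse (1 - μ • (G ∘L K))) := by
    rw [h2, h, e2, Ring.inverse_unit, ← hv, Ring.inverse_unit, mul_inv_rev, inv_inv, e1,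
      ContinuousLinearMap.smul_comp, ContinuousLinearMap.neg_comp, smul_neg, neg_neg,
      ContinuousLinearMap.comp_assoc, Units.val_mul]
    change (1 - μ) • (K ∘L ((↑u⁻¹ : Y →L[ℝ] Y) * ((u : Y →L[ℝ] Y) * (↑v⁻¹ : Y →L[ℝ] Y)))) = _
    rw [Units.inv_mul_cancel_left]
  rw [e3] at hK'
  exact (S.smul_mem_iff (by linarith : 1 - μ ≠ 0)).1 hK'

theorem tfae_of_polynomial_approx {pU : SeminormFamily ℝ U ι} {pY : SeminormFamily ℝ Y ι}
    {S : Submodule ℝ (Y →L[ℝ] U)} {G : U →L[ℝ] Y} (hG : DiagonallyBounded pU pY G)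
    (hS : ∀ K ∈ S, DiagonallyBounded pY pU K)
    (hclosed : ∀ A : Y →L[ℝ] U,
      (∀ T, ∀ ε > 0, ∃ B ∈ S, ∀ f, pU T ((B - A) f) ≤ ε * pY T f) → A ∈ S)
    (hunit : ∀ K ∈ S, IsUnit (1 - G ∘L K))
    (happrox : ∀ K ∈ S, ∀ T, ∀ ε > 0, ∃ P : ℝ[X], ∀ f,
      pY T (Ring.inverse (1 - G ∘L K) f - aeval (G ∘L K) P f) ≤ ε * pY T f) :
    [IsQuadraticallyInvariant (S : Set (Y →L[ℝ] U)) G,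
      h G '' (S : Set (Y →L[ℝ] U)) = S,
      Convex ℝ (h G '' (S : Set (Y →L[ℝ] U)))].TFAE := by
  have hGK : ∀ K ∈ S, DiagonallyBounded pY pY (G ∘L K) := fun K hK => hG.comp (hS K hK)
  have hR : ∀ K ∈ S, DiagonallyBounded pY pY (Ring.inverse (1 - G ∘L K)) := by
    intro K hK T
    obtain ⟨P, hP⟩ := happrox K hK T 1 one_pos
    obtain ⟨C, hC, h1⟩ := (hGK K hK).aeval P T
    refine ⟨1 + C, by positivity, fun f => ?_⟩
    have h2 := hP f
    have h3 := h1 f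
    have h4 := map_add_le_add (pY T) (Ring.inverse (1 - G ∘L K) f - aeval (G ∘L K) P f)
      (aeval (G ∘L K) P f)
    rw [sub_add_cancel] at h4
    linarith
  tfae_have 1 → 2 := by
    intro hQ
    have hmem : ∀ K ∈ S, h G K ∈ S := by
      intro K hK
      refine S.neg_mem (hclosed _ fun T ε hε => ?_)
      obtain ⟨C, hC, hCK⟩ := hS K hK T
      obtain ⟨P, hP⟩ := happrox K hK T (ε / (C + 1)) (by positivity)
      refine ⟨_, hQ.comp_aeval_mem hK P, fun f => ?_⟩
      rw [sub_apply, ContinuousLinearMap.comp_apply,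
        ContinuousLinearMap.comp_apply, ← map_sub, ← map_neg_eq_map (pU T), ← map_neg, neg_sub]
      refine (hCK _).trans ((mul_le_mul_of_nonneg_left (hP f) hC).trans ?_)
      rw [← mul_assoc]
      refine mul_le_mul_of_nonneg_right ?_ (apply_nonneg _ _)
      rw [← mul_div_assoc, div_le_iff₀ (by positivity)]
      nlinarith
    refine Set.Subset.antisymm (image_subset_iff.2 hmem) fun K hK => ?_
    exact ⟨h G K, hmem K hK, h_h (hunit K hK)⟩
  tfae_have 2 → 3 := fun h2 => by rw [h2]; exact S.convex
  tfae_have 3 → 1 := by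
    intro hconv K hK
    refine hclosed _ fun T ε hε => ?_
    set a := G ∘L K with ha
    obtain ⟨C, hC, hCK⟩ := hS K hK T
    obtain ⟨D, hD, hDa⟩ := hGK K hK T
    -- The first bound keeps `μ D ≤ 1/2`, hence the resolvent bounded by `2`; the second makes the
    -- error `2 μ C D²` at most `ε`. The added ones keep the denominators positive.
    set μ : ℝ := min (1 / (2 * (D + 1))) (ε / (2 * C * D ^ 2 + 1)) with hμ
    have hμ0 : 0 < μ := lt_min (by positivity) (by positivity)
    have hμ1 : μ * (2 * (D + 1)) ≤ 1 := (le_div_iff₀ (by positivity)).1 (min_le_left _ _)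
    have hμ2 : μ * (2 * C * D ^ 2 + 1) ≤ ε := (le_div_iff₀ (by positivity)).1 (min_le_right _ _)
    have hμD : μ * D ≤ 1 / 2 := by nlinarith
    have hμlt : μ < 1 := by nlinarith
    have hu : IsUnit (1 - μ • a) := by
      have := hunit _ (S.smul_mem μ hK)
      rwa [ContinuousLinearMap.comp_smul] at this
    set R := Ring.inverse (1 - μ • a) with hRdef
    have hRb : DiagonallyBounded pY pY R := by
      have := hR _ (S.smul_mem μ hK)
      rwa [ContinuousLinearMap.comp_smul] at this
    have hRe : R = 1 + μ • (a * R) := by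
      have := Ring.mul_inverse_cancel _ hu
      rw [sub_mul, one_mul, sub_eq_iff_eq_add, smul_mul_assoc] at this
      exact this
    have hR1 : ∀ f, pY T (R f) ≤ 2 * pY T f := by
      intro f
      have h1 : R f = f + μ • a (R f) := by
        conv_lhs => rw [hRe]
        rfl
      have h2 : pY T (R f) ≤ pY T f + μ * (D * pY T (R f)) := by
        conv_lhs => rw [h1]
        refine (map_add_le_add _ _ _).trans (add_le_add le_rfl ?_)
        rw [map_smul_eq_mul, Real.norm_of_nonneg hμ0.le]
        exact mul_le_mul_of_nonneg_left (hDa _) hμ0.le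
      have h3 : 0 ≤ pY T (R f) := apply_nonneg _ _
      nlinarith
    refine ⟨μ⁻¹ • (K ∘L R - K), S.smul_mem _ (S.sub_mem
      (comp_inverse_one_sub_smul_mem hunit hconv hK hμ0.le hμlt) hK), fun f => ?_⟩
    -- Two uses of the resolvent equation `R = 1 + μ a R` give the exact remainder of the difference
    -- quotient.
    have e : (μ⁻¹ • (K ∘L R - K) - K ∘L G ∘L K) f = μ • K (a (a (R f))) := by
      have h1 : R f = f + μ • a (R f) := by
        conv_lhs => rw [hRe]
        rfl
      have h2 : K (R f) - K f = μ • K (a (R f)) := by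
        rw [← map_sub, ← map_smul]
        congr 1
        rw [sub_eq_iff_eq_add']
        exact h1
      have h3 : a (R f) - a f = μ • a (a (R f)) := by
        rw [← map_sub, ← map_smul]
        congr 1
        rw [sub_eq_iff_eq_add']
        exact h1
      change μ⁻¹ • (K (R f) - K f) - K (a f) = _
      rw [h2, smul_smul, inv_mul_cancel₀ hμ0.ne', one_smul, ← map_sub, h3, map_smul]
    rw [e, map_smul_eq_mul, Real.norm_of_nonneg hμ0.le]
    have h4 : pU T (K (a (a (R f)))) ≤ C * (D * (D * (2 * pY T f))) := by
      refine (hCK _).trans (mul_le_mul_of_nonneg_left ?_ hC)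
      refine (hDa _).trans (mul_le_mul_of_nonneg_left ?_ hD)
      exact (hDa _).trans (mul_le_mul_of_nonneg_left (hR1 f) hD)
    calc μ * pU T (K (a (a (R f)))) ≤ μ * (C * (D * (D * (2 * pY T f)))) :=
          mul_le_mul_of_nonneg_left h4 hμ0.le
      _ = (μ * (2 * C * D ^ 2)) * pY T f := by ring
      _ ≤ ε * pY T f := mul_le_mul_of_nonneg_right (by nlinarith) (apply_nonneg _ _)
  tfae_finish

/-! ### Closedness in the topology generated by balls -/

/-- In the topology generated by the balls of a monotone family of extended seminorms, closed sets
contain every point that they approximate in each of the seminorms. -/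
theorem mem_of_isClosed_generateFrom_balls {V : Type*} [AddCommGroup V] [SemilatticeSup ι]
    [Nonempty ι] {d : ι → V → ℝ≥0∞} (hmono : Monotone d)
    (hadd : ∀ T a b, d T (a + b) ≤ d T a + d T b) {S : Set V}
    (hS : IsClosed[TopologicalSpace.generateFrom
      {O | ∃ (T : ι) (A : V) (r : ℝ≥0∞), O = {B | d T (B - A) < r}}] S) {A : V}
    (hA : ∀ T, ∀ ε > (0 : ℝ), ∃ B ∈ S, d T (B - A) ≤ ENNReal.ofReal ε) : A ∈ S := by
  -- The generating balls are only a subbasis with arbitrary centres. The triangle inequality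
  -- recentres a ball at `A`, and monotonicity in the index merges a finite intersection into one
  -- seminorm.
  have key : ∀ O, TopologicalSpace.GenerateOpen
      {O | ∃ (T : ι) (A : V) (r : ℝ≥0∞), O = {B | d T (B - A) < r}} O → A ∈ O →
      ∃ T, ∃ ε > (0 : ℝ≥0∞), ∀ B, d T (B - A) < ε → B ∈ O := by
    intro O hO
    induction hO with
    | basic s hs =>
      obtain ⟨T, A₀, r, rfl⟩ := hs
      intro hA0
      refine ⟨T, r - d T (A - A₀), tsub_pos_of_lt hA0, fun B hB => ?_⟩
      rw [lt_tsub_iff_right] at hB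
      refine lt_of_le_of_lt ?_ hB
      have := hadd T (B - A) (A - A₀)
      rwa [sub_add_sub_cancel] at this
    | univ => exact fun _ => ⟨Classical.arbitrary ι, 1, one_pos, fun _ _ => trivial⟩
    | inter s t _ _ h1 h2 =>
      rintro ⟨hs, ht⟩
      obtain ⟨T₁, ε₁, hε₁, h1⟩ := h1 hs
      obtain ⟨T₂, ε₂, hε₂, h2⟩ := h2 ht
      refine ⟨T₁ ⊔ T₂, min ε₁ ε₂, lt_min hε₁ hε₂, fun B hB => ⟨h1 B ?_, h2 B ?_⟩⟩
      · exact (hmono le_sup_left _).trans_lt (hB.trans_le (min_le_left _ _))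
      · exact (hmono le_sup_right _).trans_lt (hB.trans_le (min_le_right _ _))
    | sUnion s _ ih =>
      rintro ⟨t, ht, hAt⟩
      obtain ⟨T, ε, hε, h⟩ := ih t ht hAt
      exact ⟨T, ε, hε, fun B hB => ⟨t, ht, h B hB⟩⟩
  by_contra hAS
  obtain ⟨T, ε, hε, h⟩ := key Sᶜ hS.isOpen_compl hAS
  obtain ⟨δ, hδ0, hδ⟩ := ENNReal.lt_iff_exists_nnreal_btwn.1 hε
  obtain ⟨B, hB, hd⟩ := hA T δ (by exact_mod_cast hδ0)
  rw [ENNReal.ofReal_coe_nnreal] at hd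
  exact h B (hd.trans_lt hδ) hB

end Seminorms

/-! ### Discrete time -/

namespace Ell2e

open Polynomial

variable {m n : ℕ}

@[simp]
theorem toSeq_trunc (T : ℕ) (f : Ell2e n) (t : ℕ) :
    toSeq (trunc T f) t = if t ≤ T then toSeq f t else 0 := by
  simp [trunc]

@[simp]
theorem toSeq_shift (T : ℕ) (f : Ell2e n) (t : ℕ) :
    toSeq (shift T f) t = if t < T then 0 else toSeq f (t - T) := by
  simp [shift]

theorem ext {f g : Ell2e n} (h : ∀ t, toSeq f t = toSeq g t) : f = g :=
  toSeq.injective (funext h)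

theorem truncLp_apply (T : ℕ) (f : Ell2e n) (t : ℕ) :
    truncLp T f t = toSeq (trunc T f) t := rfl

theorem seminorm_apply (T : ℕ) (f : Ell2e n) : seminorm n T f = ‖truncLp T f‖ := rfl

theorem norm_toSeq_le_seminorm {t T : ℕ} (ht : t ≤ T) (f : Ell2e n) :
    ‖toSeq f t‖ ≤ seminorm n T f := by
  have := lp.norm_apply_le_norm (p := 2) two_ne_zero (truncLp T f) t
  rwa [truncLp_apply, toSeq_trunc, if_pos ht] at this

theorem seminorm_le_sum (T : ℕ) (f : Ell2e n) :
    seminorm n T f ≤ ∑ t ∈ Finset.range (T + 1), ‖toSeq f t‖ := by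
  have h : truncLp T f = ∑ t ∈ Finset.range (T + 1), lp.single 2 t (toSeq f t) := by
    ext s : 2
    rw [truncLp_apply, toSeq_trunc, lp.coeFn_sum, Finset.sum_apply]
    simp only [lp.single_apply]
    simp [Pi.single_apply]
  rw [seminorm_apply, h]
  refine (norm_sum_le _ _).trans (Finset.sum_le_sum fun t _ => ?_)
  rw [lp.norm_single (by norm_num)]

theorem seminorm_mono_of_norm_le {R T : ℕ} {f g : Ell2e n}
    (h : ∀ t, ‖toSeq (trunc R f) t‖ ≤ ‖toSeq (trunc T g) t‖) :
    seminorm n R f ≤ seminorm n T g :=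
  lp.norm_mono two_ne_zero h

theorem seminorm_trunc_le (T R : ℕ) (f : Ell2e n) :
    seminorm n R (trunc T f) ≤ seminorm n T f := by
  refine seminorm_mono_of_norm_le fun t => ?_
  by_cases h1 : t ≤ R <;> by_cases h2 : t ≤ T <;> simp [h1, h2]

theorem seminorm_mono {R T : ℕ} (h : R ≤ T) (f : Ell2e n) : seminorm n R f ≤ seminorm n T f := by
  refine seminorm_mono_of_norm_le fun t => ?_
  by_cases h1 : t ≤ R
  · simp [h1, h1.trans h]
  · simp [h1]

theorem seminorm_congr {T : ℕ} {f g : Ell2e n} (h : trunc T f = trunc T g) :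
    seminorm n T f = seminorm n T g :=
  le_antisymm (seminorm_mono_of_norm_le fun t => by rw [h])
    (seminorm_mono_of_norm_le fun t => by rw [h])

theorem IsCausalLTI.diagonallyBounded {A : Ell2e m →L[ℝ] Ell2e n} (hA : IsCausalLTI A) :
    DiagonallyBounded (seminorm m) (seminorm n) A :=
  DiagonallyBounded.of_causal (withSeminorms m) (withSeminorms n) trunc
    (fun T R f => seminorm_trunc_le T R f) fun T f => (seminorm_congr (hA.1 T f)).ge

theorem eq_zero_of_seminorm {f : Ell2e n} (h : ∀ T, seminorm n T f = 0) : f = 0 := by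
  refine ext fun t => ?_
  have := norm_toSeq_le_seminorm le_rfl (t := t) f
  rw [h] at this
  simpa using this

/-- Each seminorm lies below a finite sum of norms of values, so summing the series pointwise in
time is enough. -/
theorem seriesComplete (n : ℕ) : SeriesComplete (seminorm n) := by
  intro x hx
  have hs : ∀ t, Summable fun k => toSeq (x k) t := fun t =>
    Summable.of_norm_bounded (hx t) fun k => norm_toSeq_le_seminorm le_rfl _
  refine ⟨toSeq.symm fun t => ∑' k, toSeq (x k) t, fun T => ?_⟩
  refine squeeze_zero (fun _ => apply_nonneg _ _) (fun m => seminorm_le_sum T _) ?_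
  have : (0 : ℝ) = ∑ t ∈ Finset.range (T + 1), 0 := by simp
  rw [this]
  refine tendsto_finsetSum _ fun t _ => ?_
  have h1 := ((hs t).hasSum.tendsto_sum_nat).const_sub (∑' k, toSeq (x k) t)
  rw [sub_self] at h1
  have h2 := h1.norm
  rw [norm_zero] at h2
  refine h2.congr fun m => ?_
  rw [map_sub, map_sum, LinearEquiv.apply_symm_apply, Pi.sub_apply, Finset.sum_apply]

/-! ### Strictly causal operators -/

theorem seminorm_pow_eq_zero {N : Ell2e n →L[ℝ] Ell2e n}
    (hshift : ∀ T f, shift T (N f) = N (shift T f)) (hN : ∀ f, toSeq (N f) 0 = 0) {k T : ℕ}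
    (hT : T < k) (f : Ell2e n) : seminorm n T ((N ^ k) f) = 0 := by
  have hvanish : ∀ k : ℕ, ∀ t < k, toSeq ((N ^ k) f) t = 0 := by
    intro k
    induction k with
    | zero => intro t ht; omega
    | succ k ih =>
      intro t ht
      -- Here `t ≤ k`, so `Nᵏ f` vanishes before `t` and is a shift by `t`. Since `N` commutes with
      -- the shift and its output vanishes at time `0`, each application gains one more zero.
      have e : (N ^ k) f = shift t (toSeq.symm fun u => toSeq ((N ^ k) f) (u + t)) := by
        refine ext fun u => ?_
        rw [toSeq_shift]
        split_ifs with hu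
        · exact ih u (by omega)
        · rw [LinearEquiv.apply_symm_apply, Nat.sub_add_cancel (not_lt.1 hu)]
      rw [pow_succ', mul_apply_eq_comp, e, ← hshift, toSeq_shift, if_neg (lt_irrefl t),
        Nat.sub_self, hN]
  refine le_antisymm ((seminorm_le_sum T _).trans_eq ?_) (apply_nonneg _ _)
  refine Finset.sum_eq_zero fun t ht => ?_
  rw [hvanish k t (by have := Finset.mem_range.1 ht; omega), norm_zero]

theorem isUnit_one_sub_of_strictlyCausal {N : Ell2e n →L[ℝ] Ell2e n}
    (hbdd : DiagonallyBounded (seminorm n) (seminorm n) N)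
    (hshift : ∀ T f, shift T (N f) = N (shift T f)) (hN : ∀ f, toSeq (N f) 0 = 0) :
    IsUnit (1 - N) ∧ ∀ T, ∀ ε > 0, ∃ m : ℕ, ∀ f,
      seminorm n T (Ring.inverse (1 - N) f - (∑ k ∈ Finset.range m, N ^ k) f) ≤
        ε * seminorm n T f := by
  refine isUnit_one_sub_of_summable (withSeminorms n) (fun _ => eq_zero_of_seminorm)
    (seriesComplete n) fun T => ?_
  obtain ⟨C, hC, h⟩ := hbdd T
  -- Powers beyond `T` vanish on the horizon, so the Neumann series is finite there and the size of
  -- `C` is irrelevant.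
  refine ⟨fun k => if k ≤ T then C ^ k else 0, summable_of_hasFiniteSupport
    ((Set.finite_Iic T).subset fun k hk => ?_), fun k f => ?_⟩
  · by_contra hT
    simp only [mem_Iic] at hT
    exact hk (if_neg hT)
  · dsimp only
    split_ifs with hk
    · clear hk
      induction k with
      | zero => simp
      | succ k ih =>
        rw [pow_succ', mul_apply_eq_comp, pow_succ', mul_assoc]
        exact (h _).trans (mul_le_mul_of_nonneg_left ih hC)
    · rw [seminorm_pow_eq_zero hshift hN (not_le.1 hk), zero_mul]

/-! ### Reduction of causal operators to strictly causal ones -/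

/-- The response at time `0` as a linear function of the input at time `0`. -/
def zeroResponse (A : Ell2e n →L[ℝ] Ell2e n) : Module.End ℝ (E n) :=
  LinearMap.proj 0 ∘ₗ toSeq.toLinearMap ∘ₗ (A : Ell2e n →ₗ[ℝ] Ell2e n) ∘ₗ
    toSeq.symm.toLinearMap ∘ₗ LinearMap.single ℝ (fun _ => E n) 0

theorem toSeq_zero_eq_zeroResponse {A : Ell2e n →L[ℝ] Ell2e n} (hA : IsCausalLTI A)
    (f : Ell2e n) : toSeq (A f) 0 = zeroResponse A (toSeq f 0) := by
  have h := congrArg (fun g => toSeq g 0) (hA.1 0 f)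
  simp only [toSeq_trunc, le_refl, if_true] at h
  rw [← h]
  have e : trunc 0 f = toSeq.symm (Pi.single 0 (toSeq f 0)) := by
    refine ext fun t => ?_
    rw [toSeq_trunc, LinearEquiv.apply_symm_apply, Pi.single_apply]
    by_cases ht : t = 0 <;> simp [ht]
  rw [e]
  rfl

theorem zeroResponse_apply (A : Ell2e n →L[ℝ] Ell2e n) (x : E n) (i : Fin n) :
    zeroResponse A x i = (impulseResponse A 0).mulVec x i := by
  have hx : x = ∑ j, x j • EuclideanSpace.single j (1 : ℝ) := by
    ext i
    simp [Pi.single_apply]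
  have himp : ∀ j, zeroResponse A (EuclideanSpace.single j 1) i = impulseResponse A 0 i j := by
    intro j
    have : (impulse j : Ell2e n) =
        toSeq.symm (Pi.single 0 (EuclideanSpace.single j (1 : ℝ))) := by
      refine ext fun t => ?_
      rw [impulse, LinearEquiv.apply_symm_apply, LinearEquiv.apply_symm_apply, Pi.single_apply]
    rw [impulseResponse, Matrix.of_apply, this]
    rfl
  conv_lhs => rw [hx]
  rw [map_sum]
  simp only [map_smul, WithLp.ofLp_sum, Finset.sum_apply, PiLp.smul_apply, himp, smul_eq_mul,
    Matrix.mulVec, dotProduct]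
  exact Finset.sum_congr rfl fun j _ => mul_comm _ _

/-- A spectral radius below `1` excludes the eigenvalue `1`. The complex determinant of `1 - M` is
the image of the real one, so the real determinant is nonzero too. -/
theorem injective_one_sub_zeroResponse {A : Ell2e n →L[ℝ] Ell2e n}
    (hA : spectralRadius ℂ ((impulseResponse A 0).map (algebraMap ℝ ℂ)) < 1) :
    Function.Injective (1 - zeroResponse A : Module.End ℝ (E n)) := by
  set M := impulseResponse A 0 with hM
  have h1 : IsUnit (1 - M.map (algebraMap ℝ ℂ)) := by
    by_contra hn
    have : (1 : ℂ) ∈ spectrum ℂ (M.map (algebraMap ℝ ℂ)) := by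
      rw [spectrum.mem_iff, map_one]
      exact hn
    have h2 : ((‖(1 : ℂ)‖₊ : ℝ≥0) : ℝ≥0∞) ≤ spectralRadius ℂ (M.map (algebraMap ℝ ℂ)) :=
      le_iSup₂ (f := fun (k : ℂ) (_ : k ∈ spectrum ℂ (M.map (algebraMap ℝ ℂ))) =>
        ((‖k‖₊ : ℝ≥0) : ℝ≥0∞)) 1 this
    simp only [nnnorm_one, ENNReal.coe_one] at h2
    exact absurd hA (not_lt.2 h2)
  have h2 : (1 - M).det ≠ 0 := by
    have h3 : 1 - M.map (algebraMap ℝ ℂ) = (1 - M).map (algebraMap ℝ ℂ) := by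
      rw [Matrix.map_sub _ (map_sub _), Matrix.map_one _ (map_zero _) (map_one _)]
    rw [h3, Matrix.isUnit_iff_isUnit_det, ← RingHom.mapMatrix_apply, ← RingHom.map_det] at h1
    intro h0
    rw [h0, map_zero] at h1
    exact not_isUnit_zero h1
  rw [injective_iff_map_eq_zero]
  intro x hx
  have h4 : (1 - M).mulVec x = 0 := by
    ext i
    rw [Matrix.sub_mulVec, Matrix.one_mulVec, Pi.sub_apply, ← zeroResponse_apply]
    exact congrArg (fun y : E n => y i) hx
  have h5 := Matrix.eq_zero_of_mulVec_eq_zero h2 h4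
  ext i
  exact congrFun h5 i

theorem shift_aeval {A : Ell2e n →L[ℝ] Ell2e n} (hA : ∀ T f, shift T (A f) = A (shift T f))
    (P : ℝ[X]) (T : ℕ) (f : Ell2e n) : shift T (aeval A P f) = aeval A P (shift T f) := by
  have hadd : ∀ f g : Ell2e n, shift T (f + g) = shift T f + shift T g := by
    intro f g
    refine ext fun t => ?_
    rw [map_add, Pi.add_apply, toSeq_shift, toSeq_shift, toSeq_shift, map_add, Pi.add_apply]
    split_ifs <;> simp
  have hsmul : ∀ (c : ℝ) (f : Ell2e n), shift T (c • f) = c • shift T f := by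
    intro c f
    refine ext fun t => ?_
    rw [map_smul, Pi.smul_apply, toSeq_shift, toSeq_shift, map_smul, Pi.smul_apply]
    split_ifs <;> simp
  induction P using Polynomial.induction_on' with
  | add P Q hP hQ => simp only [map_add, add_apply, hadd, hP, hQ]
  | monomial k c =>
    rw [aeval_monomial, ← Algebra.smul_def, smul_apply, smul_apply, hsmul]
    congr 1
    induction k with
    | zero => rfl
    | succ k ih => rw [pow_succ', mul_apply_eq_comp, hA, ih, mul_apply_eq_comp]

theorem toSeq_aeval_zero {A : Ell2e n →L[ℝ] Ell2e n} {L : Module.End ℝ (E n)}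
    (hA : ∀ f, toSeq (A f) 0 = L (toSeq f 0)) (P : ℝ[X]) (f : Ell2e n) :
    toSeq (aeval A P f) 0 = aeval L P (toSeq f 0) := by
  induction P using Polynomial.induction_on' with
  | add P Q hP hQ => rw [map_add, map_add, add_apply, map_add, Pi.add_apply, hP, hQ]; rfl
  | monomial k c =>
    rw [aeval_monomial, aeval_monomial, ← Algebra.smul_def, ← Algebra.smul_def, smul_apply,
      map_smul, Pi.smul_apply, LinearMap.smul_apply]
    congr 1
    induction k with
    | zero => rfl
    | succ k ih => rw [pow_succ', mul_apply_eq_comp, hA, ih, pow_succ', Module.End.mul_apply]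

/-- The Neumann series is taken in `N = ν(A)` instead of `A`, where `N` is strictly causal and `1 -
N = (1 - A) V` with `V = v(A)`. Then `(1 - A)⁻¹ = V (1 - N)⁻¹`, a limit of polynomials in `A`. -/
theorem isUnit_one_sub_of_spectralRadius_lt {A : Ell2e n →L[ℝ] Ell2e n} (hA : IsCausalLTI A)
    (hρ : spectralRadius ℂ ((impulseResponse A 0).map (algebraMap ℝ ℂ)) < 1) :
    IsUnit (1 - A) ∧ ∀ T, ∀ ε > 0, ∃ P : ℝ[X], ∀ f,
      seminorm n T (Ring.inverse (1 - A) f - aeval A P f) ≤ ε * seminorm n T f := by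
  set L := 1 - zeroResponse A with hL
  set c := (minpoly ℝ L).coeff 0 with hc
  have hc0 : c ≠ 0 := LinearMap.minpoly_coeff_zero_of_injective (injective_one_sub_zeroResponse hρ)
  -- Normalised so that `ν(1) = 1`, which makes `1 - X` divide `1 - ν`; the substitution `1 - X`
  -- turns annihilation of `L` into annihilation of the response at time `0`.
  set ν : ℝ[X] := (C c⁻¹ * minpoly ℝ L).comp (1 - X) with hν
  set v : ℝ[X] := (C (-c⁻¹) * (minpoly ℝ L).divX).comp (1 - X) with hv
  have hνv : 1 - ν = (1 - X) * v := by
    have h1 : 1 - C c⁻¹ * minpoly ℝ L = X * (C (-c⁻¹) * (minpoly ℝ L).divX) := by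
      have h2 := divX_mul_X_add (minpoly ℝ L)
      conv_lhs => rw [← h2]
      rw [mul_add, ← hc, ← C_mul, inv_mul_cancel₀ hc0, C_neg, C_1]
      ring
    have h2 := congrArg (fun q : ℝ[X] => q.comp (1 - X)) h1
    simpa only [sub_comp, one_comp, mul_comp, X_comp, hν, hv] using h2
  set N := aeval A ν with hN
  set V := aeval A v with hV
  have e : 1 - N = (1 - A) * V := by
    have := congrArg (aeval A) hνv
    simpa using this
  have hcomm : Commute (1 - A) V := by
    have := (Commute.all (1 - X) v).map (aeval A)
    simpa using this
  have hAs : ∀ T f, shift T (A f) = A (shift T f) := by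
    intro T f
    rcases Nat.eq_zero_or_pos T with rfl | hT
    · have h0 : ∀ g : Ell2e n, shift 0 g = g := fun g => ext fun t => by simp
      rw [h0, h0]
    · exact hA.2 T hT f
  have hN0 : ∀ f, toSeq (N f) 0 = 0 := by
    intro f
    rw [hN, toSeq_aeval_zero (toSeq_zero_eq_zeroResponse hA), hν, aeval_comp]
    have : aeval (zeroResponse A) (1 - X : ℝ[X]) = L := by simp [hL]
    rw [this, map_mul, minpoly.aeval, mul_zero]
    rfl
  have hVb := hA.diagonallyBounded.aeval v
  obtain ⟨hu, happ⟩ := isUnit_one_sub_of_strictlyCausal (hA.diagonallyBounded.aeval ν)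
    (shift_aeval hAs ν) hN0
  rw [← hN] at hu happ
  have hu' : IsUnit (1 - A) := by
    rw [e, hcomm.isUnit_mul_iff] at hu
    exact hu.1
  refine ⟨hu', fun T ε hε => ?_⟩
  obtain ⟨D, hD, hVD⟩ := hVb T
  obtain ⟨k, hk⟩ := happ T (ε / (D + 1)) (by positivity)
  refine ⟨v * ∑ i ∈ Finset.range k, ν ^ i, fun f => ?_⟩
  have hinv : Ring.inverse (1 - A) = V * Ring.inverse (1 - N) := by
    have h1 : (1 - A) * (V * Ring.inverse (1 - N)) = 1 := by
      rw [← mul_assoc, ← e, Ring.mul_inverse_cancel _ hu]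
    calc Ring.inverse (1 - A) = Ring.inverse (1 - A) * ((1 - A) * (V * Ring.inverse (1 - N))) := by
          rw [h1, mul_one]
      _ = V * Ring.inverse (1 - N) := by rw [Ring.inverse_mul_cancel_left _ _ hu']
  have hsum : aeval A (v * ∑ i ∈ Finset.range k, ν ^ i) = V * ∑ i ∈ Finset.range k, N ^ i := by
    simp [hV, hN]
  rw [hinv, hsum, mul_apply_eq_comp, mul_apply_eq_comp, ← map_sub]
  refine (hVD _).trans ((mul_le_mul_of_nonneg_left (hk f) hD).trans ?_)
  rw [← mul_assoc]
  refine mul_le_mul_of_nonneg_right ?_ (apply_nonneg _ _)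
  rw [← mul_div_assoc, div_le_iff₀ (by positivity)]
  nlinarith

/-! ### Operator norms and the discrete-time equivalence -/

theorem IsCausalLTI.comp {l : ℕ} {A : Ell2e m →L[ℝ] Ell2e n} {B : Ell2e l →L[ℝ] Ell2e m}
    (hA : IsCausalLTI A) (hB : IsCausalLTI B) : IsCausalLTI (A ∘L B) := by
  refine ⟨fun T f => ?_, fun T hT f => ?_⟩
  · change trunc T (A (B (trunc T f))) = trunc T (A (B f))
    rw [← hA.1, hB.1, hA.1]
  · change shift T (A (B f)) = A (B (shift T f))
    rw [hA.2 T hT, hB.2 T hT]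

theorem opNorm_mono : Monotone (opNorm (m := m) (n := n)) := fun _ _ h _ =>
  iSup₂_mono fun _ _ => ENNReal.ofReal_le_ofReal (seminorm_mono h _)

theorem opNorm_add_le (T : ℕ) (A B : Ell2e m →L[ℝ] Ell2e n) :
    opNorm T (A + B) ≤ opNorm T A + opNorm T B := by
  refine iSup₂_le fun f hf => ?_
  refine (ENNReal.ofReal_le_ofReal (map_add_le_add (seminorm n T) _ _)).trans
    (ENNReal.ofReal_add_le.trans (add_le_add ?_ ?_))
  · exact le_iSup₂ (f := fun (f : lp (fun _ : ℕ => E m) 2) (_ : ‖f‖ ≤ 1) =>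
      ENNReal.ofReal (seminorm n T (A (toSeq.symm (f : ℕ → E m))))) f hf
  · exact le_iSup₂ (f := fun (f : lp (fun _ : ℕ => E m) 2) (_ : ‖f‖ ≤ 1) =>
      ENNReal.ofReal (seminorm n T (B (toSeq.symm (f : ℕ → E m))))) f hf

/-- Truncation is a contraction of `ℓ₂`, so a bound by the `T`-seminorm of the input implies one by
its full norm. -/
theorem opNorm_le {T : ℕ} {A : Ell2e m →L[ℝ] Ell2e n} {ε : ℝ} (hε : 0 ≤ ε)
    (hA : ∀ f, seminorm n T (A f) ≤ ε * seminorm m T f) : opNorm T A ≤ ENNReal.ofReal ε := by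
  refine iSup₂_le fun f hf => ENNReal.ofReal_le_ofReal ((hA _).trans ?_)
  refine mul_le_of_le_one_right hε (le_trans ?_ hf)
  refine lp.norm_mono two_ne_zero fun t => ?_
  rw [truncLp_apply, toSeq_trunc, LinearEquiv.apply_symm_apply]
  split_ifs <;> simp

theorem tfae_of_isInert {nu ny : ℕ} {G : Ell2e nu →L[ℝ] Ell2e ny}
    {S : Submodule ℝ (Ell2e ny →L[ℝ] Ell2e nu)} (hG : IsCausalLTI G)
    (hS : ∀ K ∈ S, IsCausalLTI K)
    (hclosed : IsClosed[opTopology ny nu] (S : Set (Ell2e ny →L[ℝ] Ell2e nu)))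
    (hinert : IsInert (S : Set (Ell2e ny →L[ℝ] Ell2e nu)) G) :
    (∀ K ∈ S, IsUnit (1 - G ∘L K)) ∧
      [IsQuadraticallyInvariant (S : Set (Ell2e ny →L[ℝ] Ell2e nu)) G,
        h G '' (S : Set (Ell2e ny →L[ℝ] Ell2e nu)) = S,
        Convex ℝ (h G '' (S : Set (Ell2e ny →L[ℝ] Ell2e nu)))].TFAE := by
  have hunit := fun K hK =>
    isUnit_one_sub_of_spectralRadius_lt (hG.comp (hS K hK)) (hinert K hK)
  refine ⟨fun K hK => (hunit K hK).1, tfae_of_polynomial_approx hG.diagonallyBounded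
    (fun K hK => (hS K hK).diagonallyBounded) (fun A hA => ?_) (fun K hK => (hunit K hK).1)
    fun K hK => (hunit K hK).2⟩
  refine mem_of_isClosed_generateFrom_balls opNorm_mono opNorm_add_le hclosed fun T ε hε => ?_
  obtain ⟨B, hB, h⟩ := hA T ε hε
  exact ⟨B, hB, opNorm_le hε.le h⟩

end Ell2e

/-! ### Continuous time -/

namespace L2e

variable {m n : ℕ}

/-- Lebesgue measure on `[0, T]`. -/
abbrev horizon (T : ℝ) : Measure ℝ := timeMeasure.restrict (Iic T)

theorem horizon_eq (T : ℝ) : horizon T = volume.restrict (Icc 0 T) := by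
  rw [horizon, timeMeasure, Measure.restrict_restrict measurableSet_Iic, inter_comm,
    Ici_inter_Iic]

instance (T : ℝ) : IsFiniteMeasure (horizon T) := by
  rw [horizon_eq]
  infer_instance

theorem horizon_univ (T : ℝ≥0) : horizon T univ = T := by
  rw [horizon_eq]
  simp

theorem horizon_le (T : ℝ) : horizon T ≤ timeMeasure := Measure.restrict_le_self

theorem toAE_injective : Function.Injective (toAE : L2e n → (ℝ →ₘ[timeMeasure] E n)) :=
  Subtype.val_injective

theorem toAE_trunc (T : ℝ≥0) (f : L2e n) :
    toAE (trunc T f) =ᵐ[timeMeasure] (Iic (T : ℝ)).indicator (toAE f) :=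
  AEEqFun.coeFn_mk _ _

theorem seminorm_eq_trunc (T : ℝ≥0) (f : L2e n) :
    seminorm n T f = (eLpNorm (toAE (trunc T f)) 2 timeMeasure).toReal :=
  Lp.norm_def _

theorem eLpNorm_trunc (T : ℝ≥0) (f : L2e n) :
    eLpNorm (toAE (trunc T f)) 2 timeMeasure = eLpNorm (toAE f) 2 (horizon T) := by
  rw [eLpNorm_congr_ae (toAE_trunc T f), eLpNorm_indicator_eq_eLpNorm_restrict measurableSet_Iic]

theorem seminorm_eq (T : ℝ≥0) (f : L2e n) :
    seminorm n T f = (eLpNorm (toAE f) 2 (horizon T)).toReal := by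
  rw [seminorm_eq_trunc, eLpNorm_trunc]

theorem memLp_horizon (T : ℝ≥0) (f : L2e n) : MemLp (toAE f) 2 (horizon T) := by
  refine ⟨(toAE f).aestronglyMeasurable.mono_measure (horizon_le _), ?_⟩
  rw [← eLpNorm_trunc]
  exact (Lp.mem_Lp_iff_memLp.1 (truncAE_mem_Lp T f)).2

theorem exists_toAE_ae_eq {g : ℝ → E n} (hg : AEStronglyMeasurable g timeMeasure)
    (hg' : ∀ T : ℝ≥0, MemLp g 2 (horizon T)) : ∃ f : L2e n, toAE f =ᵐ[timeMeasure] g := by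
  have hmem : AEEqFun.mk g hg ∈ L2eSubmodule n := by
    intro T
    refine Lp.mem_Lp_iff_memLp.2 ?_
    refine (((memLp_indicator_iff_restrict measurableSet_Iic).2 (hg' T)).ae_eq ?_)
    refine Filter.EventuallyEq.trans ?_ (AEEqFun.coeFn_mk _ _).symm
    filter_upwards [AEEqFun.coeFn_mk g hg] with t ht
    by_cases h : t ∈ Iic (T : ℝ) <;> simp [h, ht]
  exact ⟨(⟨AEEqFun.mk g hg, hmem⟩ : L2eSubmodule n), AEEqFun.coeFn_mk g hg⟩

theorem toAE_sub (f g : L2e n) :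
    toAE (f - g) =ᵐ[timeMeasure] fun t => toAE f t - toAE g t := by
  rw [map_sub]
  exact AEEqFun.coeFn_sub _ _

theorem seminorm_eq_zero_iff {T : ℝ≥0} {f : L2e n} :
    seminorm n T f = 0 ↔ ∀ᵐ t ∂horizon T, toAE f t = 0 := by
  rw [seminorm_eq, ENNReal.toReal_eq_zero_iff, or_iff_left (memLp_horizon T f).2.ne,
    eLpNorm_eq_zero_iff (memLp_horizon T f).1 two_ne_zero]
  rfl

theorem ae_timeMeasure_of_ae_horizon {P : ℝ → Prop}
    (h : ∀ k : ℕ, ∀ᵐ t ∂horizon (k : ℝ), P t) : ∀ᵐ t ∂timeMeasure, P t := by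
  have h1 : ∀ᵐ t ∂timeMeasure, ∀ k : ℕ, t ∈ Iic (k : ℝ) → P t :=
    ae_all_iff.2 fun k => (ae_restrict_iff' measurableSet_Iic).1 (h k)
  filter_upwards [h1] with t ht
  obtain ⟨k, hk⟩ := exists_nat_ge t
  exact ht k hk

theorem seminorm_mono {R T : ℝ≥0} (h : R ≤ T) (f : L2e n) :
    seminorm n R f ≤ seminorm n T f := by
  rw [seminorm_eq, seminorm_eq]
  exact ENNReal.toReal_mono (memLp_horizon T f).2.ne
    (eLpNorm_mono_measure _ (Measure.restrict_mono (Iic_subset_Iic.2 (NNReal.coe_le_coe.2 h)) le_rfl))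

theorem seminorm_trunc_le (T R : ℝ≥0) (f : L2e n) :
    seminorm n R (trunc T f) ≤ seminorm n T f := by
  rw [seminorm_eq, seminorm_eq]
  refine ENNReal.toReal_mono (memLp_horizon T f).2.ne ?_
  rw [← eLpNorm_trunc T f]
  exact eLpNorm_mono_measure _ (horizon_le _)

theorem seminorm_congr {T : ℝ≥0} {f g : L2e n} (h : trunc T f = trunc T g) :
    seminorm n T f = seminorm n T g := by
  rw [seminorm_eq_trunc, h, ← seminorm_eq_trunc]

theorem IsCausalLTI.diagonallyBounded {A : L2e m →L[ℝ] L2e n} (hA : IsCausalLTI A) :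
    DiagonallyBounded (seminorm m) (seminorm n) A :=
  DiagonallyBounded.of_causal (withSeminorms m) (withSeminorms n) trunc
    (fun T R f => seminorm_trunc_le T R f) fun T f => (seminorm_congr (hA.1 T f)).ge

theorem eq_zero_of_seminorm {f : L2e n} (h : ∀ T, seminorm n T f = 0) : f = 0 := by
  refine toAE_injective (AEEqFun.ext ?_)
  rw [map_zero]
  have : ∀ᵐ t ∂timeMeasure, toAE f t = 0 := by
    refine ae_timeMeasure_of_ae_horizon fun k => ?_
    have := seminorm_eq_zero_iff.1 (h (k : ℝ≥0))
    rwa [NNReal.coe_natCast] at this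
  filter_upwards [this, AEEqFun.coeFn_zero (α := ℝ) (β := E n) (μ := timeMeasure)] with t h1 h2
  rw [h1, h2]
  rfl

/-! ### Completeness of the extended space -/

theorem exists_glue (z : ℕ → L2e n)
    (hz : ∀ j k : ℕ, j ≤ k → seminorm n (j : ℝ≥0) (z k - z j) = 0) :
    ∃ y, ∀ k : ℕ, seminorm n (k : ℝ≥0) (y - z k) = 0 := by
  -- At time `t` the representative for the first integer horizon reaching `t` is used. Only
  -- countably many representatives occur, so `g` is measurable and the exceptional null sets can be
  -- united.
  set g : ℝ → E n := fun t => toAE (z ⌈t⌉₊) t with hg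
  have hgm : StronglyMeasurable g := by
    have h1 : Measurable fun p : ℝ × ℕ => toAE (z p.2) p.1 :=
      measurable_from_prod_countable_left fun k => (toAE (z k)).stronglyMeasurable.measurable
    exact (h1.comp (measurable_id.prodMk Nat.measurable_ceil)).stronglyMeasurable
  have hgz : ∀ k : ℕ, g =ᵐ[horizon (k : ℝ)] toAE (z k) := by
    intro k
    have h1 : ∀ᵐ t ∂timeMeasure, ∀ j : ℕ, j ≤ k → t ∈ Iic (j : ℝ) → toAE (z k - z j) t = 0 := by
      refine ae_all_iff.2 fun j => ?_
      by_cases hj : j ≤ k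
      · have := seminorm_eq_zero_iff.1 (hz j k hj)
        rw [NNReal.coe_natCast] at this
        filter_upwards [(ae_restrict_iff' measurableSet_Iic).1 this] with t ht _
        exact ht
      · exact Filter.Eventually.of_forall fun t h => absurd h hj
    have h2 : ∀ᵐ t ∂timeMeasure, ∀ j : ℕ, toAE (z k - z j) t = toAE (z k) t - toAE (z j) t :=
      ae_all_iff.2 fun j => toAE_sub _ _
    refine (ae_restrict_iff' measurableSet_Iic).2 ?_
    filter_upwards [h1, h2] with t h1 h2 ht
    have h3 := h1 ⌈t⌉₊ (Nat.ceil_le.2 ht) (Nat.le_ceil t)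
    rw [h2, sub_eq_zero] at h3
    exact h3.symm
  obtain ⟨y, hy⟩ := exists_toAE_ae_eq hgm.aestronglyMeasurable fun T => by
    obtain ⟨k, hk⟩ := exists_nat_ge (T : ℝ)
    have h1 := memLp_horizon (k : ℝ≥0) (z k)
    rw [NNReal.coe_natCast] at h1
    exact (h1.ae_eq (hgz k).symm).mono_measure
      (Measure.restrict_mono (Iic_subset_Iic.2 hk) le_rfl)
  refine ⟨y, fun k => seminorm_eq_zero_iff.2 ?_⟩
  rw [NNReal.coe_natCast]
  filter_upwards [hgz k, ae_restrict_of_ae hy, ae_restrict_of_ae (toAE_sub y (z k))]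
    with t h1 h2 h3
  rw [h3, h2, h1, sub_self]

theorem exists_toAE_eq_Lp (F : Lp (E n) 2 timeMeasure) :
    ∃ f : L2e n, toAE f =ᵐ[timeMeasure] F :=
  exists_toAE_ae_eq (Lp.aestronglyMeasurable F) fun _ => (Lp.memLp F).restrict _

/-- On each integer horizon completeness of `L₂` gives a sum; these sums agree on common horizons
and glue to one function. -/
theorem seriesComplete (n : ℕ) : SeriesComplete (seminorm n) := by
  intro x hx
  have hs : ∀ T, Summable fun k => truncLp T (x k) := fun T => Summable.of_norm (hx T)
  choose z hz using fun k : ℕ => exists_toAE_eq_Lp (∑' i, truncLp (k : ℝ≥0) (x i))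
  have hlim : ∀ k : ℕ, Filter.Tendsto
      (fun N => seminorm n (k : ℝ≥0) (z k - ∑ i ∈ Finset.range N, x i)) Filter.atTop (𝓝 0) := by
    intro k
    have h1 := ((hs k).hasSum.tendsto_sum_nat).const_sub (∑' i, truncLp (k : ℝ≥0) (x i))
    rw [sub_self] at h1
    have h2 := h1.norm
    rw [norm_zero] at h2
    refine squeeze_zero (fun _ => apply_nonneg _ _) (fun N => ?_) h2
    rw [← map_sum, seminorm_eq, Lp.norm_def]
    refine ENNReal.toReal_mono (Lp.eLpNorm_ne_top _) ?_
    refine le_trans (le_of_eq ?_) (eLpNorm_mono_measure _ (horizon_le (k : ℝ≥0)))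
    refine eLpNorm_congr_ae ?_
    have h3 := Lp.coeFn_sub (∑' i, truncLp (k : ℝ≥0) (x i))
      (truncLp (k : ℝ≥0) (∑ i ∈ Finset.range N, x i))
    have h4 : (truncLp (k : ℝ≥0) (∑ i ∈ Finset.range N, x i) : ℝ → E n) =ᵐ[timeMeasure]
        (Iic ((k : ℝ≥0) : ℝ)).indicator (toAE (∑ i ∈ Finset.range N, x i)) :=
      toAE_trunc _ _
    filter_upwards [ae_restrict_of_ae h3, ae_restrict_of_ae h4, ae_restrict_of_ae (hz k),
      ae_restrict_of_ae (toAE_sub (z k) (∑ i ∈ Finset.range N, x i)),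
      ae_restrict_mem measurableSet_Iic] with t h3 h4 h5 h6 ht
    rw [h3, h6, h5, Pi.sub_apply, h4, indicator_of_mem ht]
  obtain ⟨y, hy⟩ := exists_glue z fun j k hjk => by
    refine le_antisymm ?_ (apply_nonneg _ _)
    have h1 := (hlim k).add (hlim j)
    rw [add_zero] at h1
    refine ge_of_tendsto' h1 fun N => ?_
    have e : z k - z j = (z k - ∑ i ∈ Finset.range N, x i) - (z j - ∑ i ∈ Finset.range N, x i) := by
      abel
    rw [e]
    refine (map_sub_le_add _ _ _).trans (add_le_add (seminorm_mono ?_ _) le_rfl)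
    exact_mod_cast hjk
  refine ⟨y, fun T => ?_⟩
  obtain ⟨k, hk⟩ := exists_nat_ge T
  refine squeeze_zero (fun _ => apply_nonneg _ _) (fun N => ?_) (hlim k)
  refine (seminorm_mono hk _).trans ?_
  have e : y - ∑ i ∈ Finset.range N, x i = (y - z k) + (z k - ∑ i ∈ Finset.range N, x i) := by
    abel
  rw [e]
  refine (map_add_le_add _ _ _).trans ?_
  rw [hy k, zero_add]

/-! ### Volterra estimates -/

theorem intervalIntegrable_norm (f : L2e n) {t : ℝ} (ht : 0 ≤ t) :
    IntervalIntegrable (fun s => ‖toAE f s‖) volume 0 t := by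
  lift t to ℝ≥0 using ht
  have h := ((memLp_horizon t f).integrable one_le_two).norm
  rw [horizon_eq] at h
  rw [intervalIntegrable_iff_integrableOn_Icc_of_le t.coe_nonneg]
  exact h

theorem norm_le_sum_abs (x : E n) : ‖x‖ ≤ ∑ i, |x i| := by
  have hx : x = ∑ j, x j • EuclideanSpace.single j (1 : ℝ) := by
    ext i
    simp [Pi.single_apply]
  conv_lhs => rw [hx]
  refine (norm_sum_le _ _).trans (Finset.sum_le_sum fun i _ => ?_)
  rw [norm_smul]
  simp

/-- This replaces the matrix convolution by a scalar Volterra inequality; `c` is the sum of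
essential bounds of the kernel entries on `[0, T]`. -/
theorem HasBoundedImpulseResponse.exists_norm_le_integral {A : L2e m →L[ℝ] L2e n}
    {k : ℝ → Matrix (Fin n) (Fin m) ℝ} (hA : HasBoundedImpulseResponse A k) (T : ℝ≥0) :
    ∃ c, 0 ≤ c ∧ ∀ f, ∀ᵐ t ∂horizon T, ‖toAE (A f) t‖ ≤ c * ∫ s in (0 : ℝ)..t, ‖toAE f s‖ := by
  have h1 : ∀ i j, ∃ M : ℝ, 0 ≤ M ∧ ∀ᵐ t ∂horizon T, |k t i j| ≤ M := by
    intro i j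
    have h := (memLp_indicator_iff_restrict measurableSet_Iic).1 (hA.1 i j T)
    refine ⟨(eLpNorm (fun t => k t i j) ∞ (horizon T)).toReal, ENNReal.toReal_nonneg, ?_⟩
    rw [eLpNorm_exponent_top]
    have hfin : eLpNormEssSup (fun t => k t i j) (horizon T) ≠ ∞ := by
      rw [← eLpNorm_exponent_top]
      exact h.2.ne
    filter_upwards [ae_le_eLpNormEssSup (f := fun t => k t i j) (μ := horizon T)] with t ht
    have := ENNReal.toReal_mono hfin ht
    simpa using this
  choose M hM hkM using h1
  set c := ∑ i, ∑ j, M i j with hc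
  have hk : ∀ᵐ u ∂(volume : Measure ℝ), u ∈ Icc (0 : ℝ) T → ∀ i j, |k u i j| ≤ M i j := by
    rw [← ae_restrict_iff' measurableSet_Icc, ← horizon_eq]
    exact ae_all_iff.2 fun i => ae_all_iff.2 fun j => hkM i j
  refine ⟨c, Finset.sum_nonneg fun i _ => Finset.sum_nonneg fun j _ => hM i j, fun f => ?_⟩
  filter_upwards [ae_restrict_of_ae (hA.2 f), ae_restrict_mem measurableSet_Iic,
    ae_restrict_of_ae (ae_restrict_mem measurableSet_Ici)] with t ht htT ht0
  -- For fixed `t` the reflection `s ↦ t - s` preserves null sets, so the almost everywhere bound on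
  -- the kernel survives inside the convolution.
  have hkt : ∀ᵐ s ∂(volume : Measure ℝ), t - s ∈ Icc (0 : ℝ) T → ∀ i j, |k (t - s) i j| ≤ M i j :=
    (Measure.measurePreserving_sub_left volume t).quasiMeasurePreserving.ae hk
  refine (norm_le_sum_abs _).trans ?_
  rw [hc, Finset.sum_mul]
  refine Finset.sum_le_sum fun i _ => ?_
  rw [ht i, ← Real.norm_eq_abs, ← intervalIntegral.integral_const_mul]
  refine intervalIntegral.norm_integral_le_of_norm_le ht0 ?_
    ((intervalIntegrable_norm f ht0).const_mul _)
  filter_upwards [hkt] with s hs hs'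
  rw [Finset.sum_mul]
  refine (norm_sum_le _ _).trans (Finset.sum_le_sum fun j _ => ?_)
  rw [norm_mul]
  refine mul_le_mul (hs ⟨sub_nonneg.2 hs'.2, ?_⟩ i j) (PiLp.norm_apply_le _ j) (norm_nonneg _)
    (hM i j)
  have h2 : t ≤ T := htT
  linarith [hs'.1]

/-- The first application bounds the output pointwise by `c` times the integral over the whole
horizon; each further one integrates `sᵏ / k!`, which produces the factorial decay. -/
theorem norm_pow_succ_le {A : L2e n →L[ℝ] L2e n} {T : ℝ≥0} {c : ℝ} (hc : 0 ≤ c)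
    (hA : ∀ f, ∀ᵐ t ∂horizon T, ‖toAE (A f) t‖ ≤ c * ∫ s in (0 : ℝ)..t, ‖toAE f s‖) (k : ℕ)
    (f : L2e n) : ∀ᵐ t ∂horizon T, ‖toAE ((A ^ (k + 1)) f) t‖ ≤
      c ^ (k + 1) * (t ^ k / k.factorial) * ∫ s in (0 : ℝ)..T, ‖toAE f s‖ := by
  induction k with
  | zero =>
    filter_upwards [hA f, ae_restrict_mem measurableSet_Iic,
      ae_restrict_of_ae (ae_restrict_mem measurableSet_Ici)] with t ht htT ht0
    simp only [zero_add, pow_one, pow_zero, Nat.factorial_zero, Nat.cast_one, div_one, mul_one]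
    refine ht.trans (mul_le_mul_of_nonneg_left ?_ hc)
    exact intervalIntegral.integral_mono_interval le_rfl ht0 htT
      (Filter.Eventually.of_forall fun _ => norm_nonneg _) (intervalIntegrable_norm f T.coe_nonneg)
  | succ k ih =>
    set J := ∫ s in (0 : ℝ)..T, ‖toAE f s‖ with hJ
    rw [horizon_eq] at ih
    filter_upwards [hA ((A ^ (k + 1)) f), ae_restrict_mem measurableSet_Iic,
      ae_restrict_of_ae (ae_restrict_mem measurableSet_Ici)] with t ht htT ht0
    rw [pow_succ' A, mul_apply_eq_comp]
    refine ht.trans ?_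
    have h1 : ∫ s in (0 : ℝ)..t, ‖toAE ((A ^ (k + 1)) f) s‖ ≤
        ∫ s in (0 : ℝ)..t, c ^ (k + 1) * (s ^ k / k.factorial) * J := by
      refine intervalIntegral.integral_mono_ae_restrict ht0 (intervalIntegrable_norm _ ht0) ?_ ?_
      · exact Continuous.intervalIntegrable (by fun_prop) _ _
      · exact ae_mono (Measure.restrict_mono (Icc_subset_Icc_right htT) le_rfl) ih
    refine (mul_le_mul_of_nonneg_left h1 hc).trans_eq ?_
    rw [intervalIntegral.integral_mul_const, intervalIntegral.integral_const_mul,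
      intervalIntegral.integral_div, integral_pow, Nat.factorial_succ]
    push_cast
    field_simp
    ring

theorem integral_norm_le_seminorm (T : ℝ≥0) (f : L2e n) :
    ∫ s in (0 : ℝ)..T, ‖toAE f s‖ ≤ √T * seminorm n T f := by
  rw [intervalIntegral.integral_of_le T.coe_nonneg, ← integral_Icc_eq_integral_Ioc, ← horizon_eq,
    integral_norm_eq_lintegral_enorm (memLp_horizon T f).1, ← eLpNorm_one_eq_lintegral_enorm,
    seminorm_eq]
  have h := eLpNorm_le_eLpNorm_mul_rpow_measure_univ (one_le_two (α := ℝ≥0∞))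
    (memLp_horizon T f).1
  rw [horizon_univ] at h
  have h3 := ENNReal.toReal_mono (ENNReal.mul_ne_top (memLp_horizon T f).2.ne
    (ENNReal.rpow_ne_top_of_nonneg (by norm_num) ENNReal.coe_ne_top)) h
  rw [ENNReal.toReal_mul, ← ENNReal.toReal_rpow, mul_comm] at h3
  convert h3 using 2
  rw [Real.sqrt_eq_rpow]
  norm_num

theorem seminorm_le_of_ae_bound {T : ℝ≥0} {f : L2e n} {C : ℝ} (hC : 0 ≤ C)
    (h : ∀ᵐ t ∂horizon T, ‖toAE f t‖ ≤ C) : seminorm n T f ≤ √T * C := by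
  have h1 := eLpNorm_le_of_ae_bound (p := 2) h
  rw [horizon_univ] at h1
  have h3 := ENNReal.toReal_mono (ENNReal.mul_ne_top
    (ENNReal.rpow_ne_top_of_nonneg (by norm_num) ENNReal.coe_ne_top) ENNReal.ofReal_ne_top) h1
  rw [ENNReal.toReal_mul, ← ENNReal.toReal_rpow, ENNReal.toReal_ofReal hC] at h3
  rw [seminorm_eq]
  convert h3 using 2
  rw [Real.sqrt_eq_rpow]
  norm_num

theorem HasBoundedImpulseResponse.isUnit_one_sub {A : L2e n →L[ℝ] L2e n}
    {k : ℝ → Matrix (Fin n) (Fin n) ℝ} (hA : HasBoundedImpulseResponse A k) :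
    IsUnit (1 - A) ∧ ∀ T, ∀ ε > 0, ∃ N : ℕ, ∀ f,
      seminorm n T (Ring.inverse (1 - A) f - (∑ i ∈ Finset.range N, A ^ i) f) ≤
        ε * seminorm n T f := by
  refine isUnit_one_sub_of_summable (withSeminorms n) (fun _ => eq_zero_of_seminorm)
    (seriesComplete n) fun T => ?_
  obtain ⟨c, hc, h⟩ := hA.exists_norm_le_integral T
  -- Index `0` is the identity. For the others, one `√T` comes from bounding the `L₁` norm of the
  -- input by its `L₂` norm, another from bounding the `L₂` norm of the output by its supremum.
  refine ⟨fun i => Nat.casesOn i 1 fun i => T * c * ((c * T) ^ i / i.factorial), ?_,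
    fun i f => ?_⟩
  · exact (summable_nat_add_iff 1).1 ((Real.summable_pow_div_factorial (c * T)).mul_left _)
  · rcases i with _ | i
    · simp
    · change seminorm n T ((A ^ (i + 1)) f) ≤
        T * c * ((c * T) ^ i / i.factorial) * seminorm n T f
      have hJ := integral_norm_le_seminorm T f
      have hs : 0 ≤ seminorm n T f := apply_nonneg _ _
      have hb : ∀ᵐ t ∂horizon T, ‖toAE ((A ^ (i + 1)) f) t‖ ≤
          c ^ (i + 1) * ((T : ℝ) ^ i / i.factorial) * (√T * seminorm n T f) := by
        filter_upwards [norm_pow_succ_le hc h i f, ae_restrict_mem measurableSet_Iic,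
          ae_restrict_of_ae (ae_restrict_mem measurableSet_Ici)] with t ht htT ht0
        have h0 : (0 : ℝ) ≤ t := ht0
        have h1 : t ≤ T := htT
        refine ht.trans ?_
        calc _ ≤ c ^ (i + 1) * (t ^ i / i.factorial) * (√T * seminorm n T f) :=
              mul_le_mul_of_nonneg_left hJ (by positivity)
          _ ≤ _ := by gcongr
      refine (seminorm_le_of_ae_bound (by positivity) hb).trans_eq ?_
      have hT : √(T : ℝ) * √(T : ℝ) = T := Real.mul_self_sqrt T.2
      calc √(T : ℝ) * (c ^ (i + 1) * ((T : ℝ) ^ i / i.factorial) * (√T * seminorm n T f)) =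
            (√(T : ℝ) * √(T : ℝ)) * (c ^ (i + 1) * ((T : ℝ) ^ i / i.factorial)) *
              seminorm n T f := by ring
        _ = _ := by rw [hT, mul_pow]; ring

/-! ### Operator norms and the continuous-time equivalence -/

theorem opNorm_mono : Monotone (opNorm (m := m) (n := n)) := fun _ _ h _ =>
  iSup₂_mono fun _ _ => ENNReal.ofReal_le_ofReal (seminorm_mono h _)

theorem opNorm_add_le (T : ℝ≥0) (A B : L2e m →L[ℝ] L2e n) :
    opNorm T (A + B) ≤ opNorm T A + opNorm T B := by
  refine iSup₂_le fun f hf => ?_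
  refine (ENNReal.ofReal_le_ofReal (map_add_le_add (seminorm n T) _ _)).trans
    (ENNReal.ofReal_add_le.trans (add_le_add ?_ ?_))
  · exact le_iSup₂ (f := fun (f : L2e m) (_ : eLpNorm (toAE f) 2 timeMeasure ≤ 1) =>
      ENNReal.ofReal (seminorm n T (A f))) f hf
  · exact le_iSup₂ (f := fun (f : L2e m) (_ : eLpNorm (toAE f) 2 timeMeasure ≤ 1) =>
      ENNReal.ofReal (seminorm n T (B f))) f hf

theorem opNorm_le {T : ℝ≥0} {A : L2e m →L[ℝ] L2e n} {ε : ℝ} (hε : 0 ≤ ε)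
    (hA : ∀ f, seminorm n T (A f) ≤ ε * seminorm m T f) : opNorm T A ≤ ENNReal.ofReal ε := by
  refine iSup₂_le fun f hf => ENNReal.ofReal_le_ofReal ((hA _).trans ?_)
  refine mul_le_of_le_one_right hε ?_
  rw [seminorm_eq]
  refine ENNReal.toReal_le_of_le_ofReal zero_le_one ?_
  rw [ENNReal.ofReal_one]
  exact (eLpNorm_mono_measure _ (horizon_le _)).trans hf

theorem tfae_of_isInert {nu ny : ℕ} {G : L2e nu →L[ℝ] L2e ny}
    {S : Submodule ℝ (L2e ny →L[ℝ] L2e nu)} (hG : IsCausalLTI G)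
    (hS : ∀ K ∈ S, IsCausalLTI K)
    (hclosed : IsClosed[opTopology ny nu] (S : Set (L2e ny →L[ℝ] L2e nu)))
    (hinert : IsInert (S : Set (L2e ny →L[ℝ] L2e nu)) G) :
    (∀ K ∈ S, IsUnit (1 - G ∘L K)) ∧
      [IsQuadraticallyInvariant (S : Set (L2e ny →L[ℝ] L2e nu)) G,
        h G '' (S : Set (L2e ny →L[ℝ] L2e nu)) = S,
        Convex ℝ (h G '' (S : Set (L2e ny →L[ℝ] L2e nu)))].TFAE := by
  have hunit : ∀ K ∈ S, IsUnit (1 - G ∘L K) ∧ ∀ T, ∀ ε > 0, ∃ N : ℕ, ∀ f,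
      seminorm ny T (Ring.inverse (1 - G ∘L K) f - (∑ i ∈ Finset.range N, (G ∘L K) ^ i) f) ≤
        ε * seminorm ny T f := by
    intro K hK
    obtain ⟨k, hk⟩ := hinert K hK
    exact hk.isUnit_one_sub
  refine ⟨fun K hK => (hunit K hK).1, tfae_of_polynomial_approx hG.diagonallyBounded
    (fun K hK => (hS K hK).diagonallyBounded) (fun A hA => ?_) (fun K hK => (hunit K hK).1)
    fun K hK T ε hε => ?_⟩
  · refine mem_of_isClosed_generateFrom_balls opNorm_mono opNorm_add_le hclosed fun T ε hε => ?_
    obtain ⟨B, hB, h⟩ := hA T ε hε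
    exact ⟨B, hB, opNorm_le hε.le h⟩
  · obtain ⟨N, hN⟩ := (hunit K hK).2 T ε hε
    -- Here the Neumann series converges in `GK` itself, so plain geometric sums serve as the
    -- polynomials.
    refine ⟨∑ i ∈ Finset.range N, Polynomial.X ^ i, ?_⟩
    simpa using hN

end L2e

end QuadInv

end

theorem corollary3 (ny nu : ℕ) :
    (∀ (G : QuadInv.L2e nu →L[ℝ] QuadInv.L2e ny)
        (S : Submodule ℝ (QuadInv.L2e ny →L[ℝ] QuadInv.L2e nu)),
        QuadInv.L2e.IsCausalLTI G →
        (∀ K ∈ S, QuadInv.L2e.IsCausalLTI K) →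
        IsClosed[QuadInv.L2e.opTopology ny nu] (S : Set (QuadInv.L2e ny →L[ℝ] QuadInv.L2e nu)) →
        QuadInv.L2e.IsInert (S : Set (QuadInv.L2e ny →L[ℝ] QuadInv.L2e nu)) G →
        (∀ K ∈ S, IsUnit (1 - G ∘L K)) ∧
          [QuadInv.IsQuadraticallyInvariant (S : Set (QuadInv.L2e ny →L[ℝ] QuadInv.L2e nu)) G,
            QuadInv.h G '' S = S,
            Convex ℝ (QuadInv.h G '' S)].TFAE) ∧
    (∀ (G : QuadInv.Ell2e nu →L[ℝ] QuadInv.Ell2e ny)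
        (S : Submodule ℝ (QuadInv.Ell2e ny →L[ℝ] QuadInv.Ell2e nu)),
        QuadInv.Ell2e.IsCausalLTI G →
        (∀ K ∈ S, QuadInv.Ell2e.IsCausalLTI K) →
        IsClosed[QuadInv.Ell2e.opTopology ny nu]
          (S : Set (QuadInv.Ell2e ny →L[ℝ] QuadInv.Ell2e nu)) →
        QuadInv.Ell2e.IsInert (S : Set (QuadInv.Ell2e ny →L[ℝ] QuadInv.Ell2e nu)) G →
        (∀ K ∈ S, IsUnit (1 - G ∘L K)) ∧
          [QuadInv.IsQuadraticallyInvariant (S : Set (QuadInv.Ell2e ny →L[ℝ] QuadInv.Ell2e nu)) G,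
            QuadInv.h G '' S = S,
            Convex ℝ (QuadInv.h G '' S)].TFAE) := by
  exact ⟨fun _ _ hG hS hclosed hinert => QuadInv.L2e.tfae_of_isInert hG hS hclosed hinert,
    fun _ _ hG hS hclosed hinert => QuadInv.Ell2e.tfae_of_isInert hG hS hclosed hinert⟩
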